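/- **Setting.** Let $d\in\{2,3\}$, let $\Omega\subset\mathbb R^d$ be a nonempty bounded open convex polygonal/polyhedral domain, $I=(0,1)$, $u_0,u_d\in H^1_0(\Omega)$, $\delta_0>0$ and $q_a<q_b$ real. The control operator $B\colon L^2(\omega)\to L^2(\Omega)$ is one of the following: (i) $\omega\subseteq\Omega$ is measurable, with Lebesgue measure (in particular, $\omega$ may be any polygonal or polyhedral subset), and $B$ is the extension by zero; (ii) $\omega=\{1,\dots,N_c\}$ with the counting measure and $Bq=\sum_{n=1}^{N_c}q_ne_n$ with given $e_n\in L^2(\Omega)$. Let $Q_{ad}(0,1)=\{q\in L^2(I\times\omega): q_a\le q\le q_b \text{ a.e.}\}$, let $W(0,1)=H^1(I;H^{-1}(\Omega))\cap L^2(I;H^1_0(\Omega))$, and let $\Delta\colon H^1_0(\Omega)\to H^{-1}(\Omega)$ be the weak Dirichlet Laplacian. For $\nu>0$ and $q\in L^2(I\times\omega)$ let $u=S(\nu,q)\in W(0,1)$ be the solution of $\partial_tu-\nu\Delta u=\nu Bq$, $u(0)=u_0$, and put $$G(v)=\tfrac12\|v-u_d\|_{L^2(\Omega)}^2-\tfrac{\delta_0^2}{2},\qquad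 g(\nu,q)=G\big(S(\nu,q)(1)\big).$$ A pair $(\nu,q)$ is *admissible* if $\nu>0$, $q\in Q_{ad}(0,1)$ and $g(\nu,q)\le0$. The transformed time-optimal problem $(\hat P)$ is to minimize $\nu$ over all admissible $(\nu,q)$. **Theorem.** Let $\bar\nu>0$ and $\bar q\in Q_{ad}(0,1)$ satisfy the first order optimality conditions with state $\bar u=S(\bar\nu,\bar q)$, multiplier $\bar\mu>0$ and adjoint state $\bar z\in W(0,1)$, i.e. $-\partial_t\bar z-\bar\nu\Delta\bar z=0$, $\bar z(1)=\bar\mu(\bar u(1)-u_d)$, and $$\int_0^1 1+\langle B\bar q(t)+\Delta\bar u(t),\bar z(t)\rangle\,dt=0,\qquad \int_0^1\langle B^*\bar z(t),q(t)-\bar q(t)\rangle_{L^2(\omega)}\,dt\ge0\ \ \text{for all } q\in Q_{ad}(0,1),\qquad G(\bar u(1))=0 .$$ Suppose moreover that the nodal set condition $|\{(t,x)\in I\times\omega:(B^*\bar z)(t,x)=0\}|=0$ holds. Then $(\bar\nu,\bar q)$ is locally optimal for $(\hat P)$: it is admissible, and there is $\delta>0$ such that $\bar\nu\le\nu$ for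 all admissible $(\nu,q)$ with $|\nu-\bar\nu|\le\delta$ (with no restriction on $q$). Furthermore, there exists a concave, continuous, strictly increasing function $\Psi\colon[0,\infty)\to[0,\infty)$ with $\Psi(0)=0$, $\lim_{\varepsilon\to\infty}\Psi(\varepsilon)=\infty$ and $$|\{(t,x)\in I\times\omega:-\varepsilon\le(B^*\bar z)(t,x)\le\varepsilon\}|\le\Psi(\varepsilon)\quad\text{for all }\varepsilon>0,$$ and for every such $\Psi$, with inverse $\Psi^{-1}\colon[0,\infty)\to[0,\infty)$ and $c_0=\frac1{2(q_b-q_a)}$, there is $\delta>0$ such that $$\frac{\bar\nu}{6}\,\Psi^{-1}\big(c_0\|q-\bar q\|_{L^1(I\times\omega)}\big)\,\|q-\bar q\|_{L^1(I\times\omega)}\le\nu-\bar\nu$$ for all admissible $(\nu,q)$ with $|\nu-\bar\nu|\le\delta$. -/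

import Mathlib

open MeasureTheory Set Filter
open scoped InnerProductSpace

noncomputable section

namespace TimeOptimal

/-- The ambient Euclidean space `ℝ^d`. -/
abbrev Sp (d : ℕ) : Type := EuclideanSpace ℝ (Fin d)

/-- A bounded open convex polytope (convex polygonal or polyhedral domain). -/
def IsConvexPolytopalDomain {d : ℕ} (Ω : Set (Sp d)) : Prop :=
  Ω.Nonempty ∧ ∃ s : Finset (Sp d), Ω = interior (convexHull ℝ (s : Set (Sp d)))

/-- `L²(Ω)`. -/
abbrev L2 {d : ℕ} (Ω : Set (Sp d)) : Type := Lp ℝ 2 (volume.restrict Ω)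

/-- `L²(Ω; ℝ^d)`. -/
abbrev L2Vec {d : ℕ} (Ω : Set (Sp d)) : Type := Lp (Sp d) 2 (volume.restrict Ω)

open scoped ContDiff in
/-- `H¹₀(Ω)`: the closure of `{(φ, ∇φ) : φ ∈ C_c^∞(Ω)}` in `L²(Ω) × L²(Ω; ℝ^d)` with the Hilbert
product norm, i.e. the closure of the test functions in the `H¹` norm; an element is stored as the
pair of the function and its weak gradient. (The pairs `(φ, ∇φ)` already form a subspace, so
that `span` adds nothing.) -/
def H10 {d : ℕ} (Ω : Set (Sp d)) : Submodule ℝ (WithLp 2 (L2 Ω × L2Vec Ω)) :=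
  (Submodule.span ℝ {w : WithLp 2 (L2 Ω × L2Vec Ω) | ∃ φ : Sp d → ℝ,
    ContDiff ℝ ∞ φ ∧ HasCompactSupport φ ∧ tsupport φ ⊆ Ω ∧
    w.fst =ᵐ[volume.restrict Ω] φ ∧
    w.snd =ᵐ[volume.restrict Ω] gradient φ}).topologicalClosure

/-- The embedding `H¹₀(Ω) → L²(Ω)`. -/
def toL2 {d : ℕ} (Ω : Set (Sp d)) : H10 Ω →L[ℝ] L2 Ω :=
  (WithLp.fstL 2 ℝ (L2 Ω) (L2Vec Ω)).comp (H10 Ω).subtypeL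

/-- The weak gradient `H¹₀(Ω) → L²(Ω; ℝ^d)`. -/
def grad {d : ℕ} (Ω : Set (Sp d)) : H10 Ω →L[ℝ] L2Vec Ω :=
  (WithLp.sndL 2 ℝ (L2 Ω) (L2Vec Ω)).comp (H10 Ω).subtypeL

/-- `H⁻¹(Ω)`, the dual of `H¹₀(Ω)`; the duality pairing is evaluation. -/
abbrev Hm1 {d : ℕ} (Ω : Set (Sp d)) : Type := StrongDual ℝ (H10 Ω)

/-- The embedding `L²(Ω) → H⁻¹(Ω)`, `f ↦ (φ ↦ (f, φ)_{L²})`. -/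
def emb {d : ℕ} (Ω : Set (Sp d)) (f : L2 Ω) : Hm1 Ω :=
  (innerSL ℝ f).comp (toL2 Ω)

/-- The Dirichlet Laplacian `Δ : H¹₀(Ω) → H⁻¹(Ω)`, `⟨Δ u, φ⟩ = -(∇u, ∇φ)_{L²}`. -/
def lap {d : ℕ} (Ω : Set (Sp d)) (u : H10 Ω) : Hm1 Ω :=
  -(innerSL ℝ (grad Ω u)).comp (grad Ω)

/-- Lebesgue measure on the reference time interval `I = (0,1)`. -/
def timeMeasure : Measure ℝ := volume.restrict (Ioo (0 : ℝ) 1)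

/-- `W(0,1) = H¹(I; H⁻¹(Ω)) ∩ L²(I; H¹₀(Ω))`. An element is given by its class `val` in
`L²(I; H¹₀)`, its weak time derivative `dt` in `L²(I; H⁻¹)` and its representative `path` in
`C([0,1]; L²(Ω))`, whose values are the traces `u(t)`; values of `path` outside `[0,1]` are
irrelevant. That `dt` is the weak derivative is expressed by the fundamental theorem of calculus
in `H⁻¹(Ω)`. -/
structure W {d : ℕ} (Ω : Set (Sp d)) where
  val : Lp (H10 Ω) 2 timeMeasure
  dt : Lp (Hm1 Ω) 2 timeMeasure
  path : ℝ → L2 Ω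
  path_continuousOn : ContinuousOn path (Icc 0 1)
  path_ae : ∀ᵐ t ∂timeMeasure, toL2 Ω (val t) = path t
  path_primitive : ∀ t ∈ Icc (0 : ℝ) 1,
    emb Ω (path t) = emb Ω (path 0) + ∫ s in (0 : ℝ)..t, dt s

/-- The control spaces `L²(ω) = L²(X, ρ)` and control operators `B : L²(ω) → L²(Ω)` considered:
* distributed control on a measurable `ω ⊆ Ω` with Lebesgue measure, `B` the extension by zero;
* purely time-dependent control, `ω = {1,…,N}` with counting measure, `B q = ∑ n, q_n e_n`. -/
inductive IsControlOperator {d : ℕ} (Ω : Set (Sp d)) :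
    (X : Type) → [MeasurableSpace X] → (ρ : Measure X) → (Lp ℝ 2 ρ →L[ℝ] L2 Ω) → Prop
  | distributed (ω : Set (Sp d)) (hω : MeasurableSet ω) (hsub : ω ⊆ Ω)
      (B : Lp ℝ 2 (volume.restrict ω) →L[ℝ] L2 Ω)
      (hB : ∀ q : Lp ℝ 2 (volume.restrict ω),
        B q =ᵐ[volume.restrict Ω] ω.indicator q) :
      IsControlOperator Ω (Sp d) (volume.restrict ω) B
  | timeDependent (N : ℕ) (e : Fin N → L2 Ω)
      (B : Lp ℝ 2 (Measure.count : Measure (Fin N)) →L[ℝ] L2 Ω)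
      (hB : ∀ q : Lp ℝ 2 (Measure.count : Measure (Fin N)), B q = ∑ n, q n • e n) :
      IsControlOperator Ω (Fin N) Measure.count B

section Control

variable {X : Type} [MeasurableSpace X] (ρ : Measure X)

/-- The measure on `I × ω`. -/
def stMeasure : Measure (ℝ × X) := timeMeasure.prod ρ

/-- `Q(0,1) = L²(I × ω)`. -/
abbrev Q : Type := Lp ℝ 2 (stMeasure ρ)

variable {ρ}

open Classical in
/-- The time slice `q(t) = q(t, ·) ∈ L²(ω)`; for almost every `t` the slice is square integrable,
at the exceptional `t` the value is `0`. -/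
def slice (q : Q ρ) (t : ℝ) : Lp ℝ 2 ρ :=
  if h : MemLp (fun x => q (t, x)) 2 ρ then h.toLp _ else 0

variable (ρ) in
/-- `Q_ad(0,1)`: the controls with `q_a ≤ q ≤ q_b` almost everywhere in `I × ω`. -/
def Qad (qa qb : ℝ) : Set (Q ρ) :=
  {q | ∀ᵐ y ∂(stMeasure ρ), qa ≤ q y ∧ q y ≤ qb}

variable {d : ℕ} {Ω : Set (Sp d)} (B : Lp ℝ 2 ρ →L[ℝ] L2 Ω)

/-- `u = S(ν, q)`: `u ∈ W(0,1)` solves `∂ₜu - ν Δu = ν B q` in `L²(I; H⁻¹)`, `u(0) = u₀`. -/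
def IsState (u₀ : H10 Ω) (ν : ℝ) (q : Q ρ) (u : W Ω) : Prop :=
  u.path 0 = toL2 Ω u₀ ∧
  ∀ᵐ t ∂timeMeasure, u.dt t - ν • lap Ω (u.val t) = ν • emb Ω (B (slice q t))

/-- The terminal constraint `G(v) = ½‖v - u_d‖² - δ₀²/2`. -/
def G (ud : H10 Ω) (δ₀ : ℝ) (v : L2 Ω) : ℝ :=
  1 / 2 * ‖v - toL2 Ω ud‖ ^ 2 - δ₀ ^ 2 / 2

/-- `(ν, q)` is admissible for the transformed problem: `ν > 0`, `q ∈ Q_ad(0,1)` and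
`g(ν, q) = G(S(ν, q)(1)) ≤ 0`. -/
def Admissible (u₀ ud : H10 Ω) (δ₀ qa qb : ℝ) (ν : ℝ) (q : Q ρ) : Prop :=
  0 < ν ∧ q ∈ Qad ρ qa qb ∧ ∃ u : W Ω, IsState B u₀ ν q u ∧ G ud δ₀ (u.path 1) ≤ 0

/-- `(ν̄, q̄)` is a (local) solution of: minimize `ν` over all admissible `(ν, q)`. The
neighbourhood restricts the time `ν` only; all controls compete. -/
def IsLocallyOptimal (u₀ ud : H10 Ω) (δ₀ qa qb : ℝ) (νb : ℝ) (qbar : Q ρ) : Prop :=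
  Admissible B u₀ ud δ₀ qa qb νb qbar ∧
  ∃ δ > 0, ∀ (ν : ℝ) (q : Q ρ), Admissible B u₀ ud δ₀ qa qb ν q → |ν - νb| ≤ δ → νb ≤ ν

/-- `-∂ₜz - ν Δz = 0` in `L²(I; H⁻¹)`, `z(1) = z₁`. -/
def IsAdjointState (ν : ℝ) (z₁ : L2 Ω) (z : W Ω) : Prop :=
  z.path 1 = z₁ ∧ ∀ᵐ t ∂timeMeasure, -z.dt t - ν • lap Ω (z.val t) = 0

/-- The first order optimality conditions at `(ν̄, q̄)` with state `ū`, multiplier `μ̄ > 0` and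
adjoint state `z̄`. -/
structure FirstOrderConditions (u₀ ud : H10 Ω) (δ₀ qa qb : ℝ) (νb : ℝ) (qbar : Q ρ)
    (ubar : W Ω) (μb : ℝ) (zbar : W Ω) : Prop where
  time_pos : 0 < νb
  control_mem : qbar ∈ Qad ρ qa qb
  state : IsState B u₀ νb qbar ubar
  multiplier_pos : 0 < μb
  adjoint : IsAdjointState νb (μb • (ubar.path 1 - toL2 Ω ud)) zbar
  hamiltonian : ∫ t in (0 : ℝ)..1,
    (1 + (emb Ω (B (slice qbar t)) + lap Ω (ubar.val t)) (zbar.val t)) = 0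
  variational : ∀ q ∈ Qad ρ qa qb,
    0 ≤ ∫ t in (0 : ℝ)..1,
      ⟪ContinuousLinearMap.adjoint B (zbar.path t), slice q t - slice qbar t⟫_ℝ
  terminal : G ud δ₀ (ubar.path 1) = 0

/-- `p ∈ L²(I × ω)` is the function `B*z`, i.e. `p(t, ·) = B*(z(t))` for almost every `t`. -/
def IsObservation (z : W Ω) (p : Q ρ) : Prop :=
  ∀ᵐ t ∂timeMeasure, slice p t = ContinuousLinearMap.adjoint B (z.path t)

end Control

/-- The structural functions for `p = B*z̄`: concave, continuous, strictly increasing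
`Ψ : [0,∞) → [0,∞)` with `Ψ(0) = 0`, `Ψ(ε) → ∞` as `ε → ∞` and
`|{-ε ≤ p ≤ ε}| ≤ Ψ(ε)` for all `ε > 0`. Values of `Ψ` on negative reals are irrelevant. -/
structure IsStructuralFunction {X : Type} [MeasurableSpace X] {ρ : Measure X} (p : Q ρ)
    (Ψ : ℝ → ℝ) : Prop where
  concave : ConcaveOn ℝ (Ici 0) Ψ
  continuousOn : ContinuousOn Ψ (Ici 0)
  strictMono : StrictMonoOn Ψ (Ici 0)
  zero : Ψ 0 = 0
  tendsto : Tendsto Ψ atTop atTop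
  measure_le : ∀ ε > 0, stMeasure ρ {y | -ε ≤ p y ∧ p y ≤ ε} ≤ ENNReal.ofReal (Ψ ε)

/-- The inverse `Ψ⁻¹ : [0,∞) → [0,∞)` of a structural function. -/
def psiInv (Ψ : ℝ → ℝ) (y : ℝ) : ℝ := Function.invFunOn Ψ (Ici 0) y

/-- `‖q₁ - q₂‖_{L¹(I × ω)}`. -/
def l1Dist {X : Type} [MeasurableSpace X] {ρ : Measure X} (q₁ q₂ : Q ρ) : ℝ :=
  ∫ y, |q₁ y - q₂ y| ∂(stMeasure ρ)

end TimeOptimal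

end

/-!
Write `p = B*z̄`. Pairing the difference of the states of `(ν, q)` and `(ν̄, q̄)` with the adjoint
state `z̄` and integrating by parts in time expresses the change of the terminal value as
`(ν - ν̄) ∫ ⟨Bq + Δu, z̄⟩ + ν̄ ⟪p, q - q̄⟫`. Convexity of `G` and the Hamiltonian condition turn
this into `ν̄ ⟪p, q - q̄⟫ ≤ (ν - ν̄)(1 - E)` for admissible `(ν, q)`, where, by an energy estimate,
`E² ≤ C (‖q - q̄‖² + (ν - ν̄)²)`.

On the other hand `q̄` minimizes `⟪p, ·⟫` over the box `Q_ad`, so `p (q - q̄) = |p| |q - q̄|` almost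
everywhere. Discarding the level set `|p| ≤ ε`, whose measure is at most `Ψ(ε)`, and choosing `ε`
with `Ψ(ε) = L / (2 (q_b - q_a))` for `L = ‖q - q̄‖_{L¹}` gives `⟪p, q - q̄⟫ ≥ ½ Ψ⁻¹(c₀ L) L`.
As `ν → ν̄`, first `L` and then `E` become small uniformly in `q`, so that `1 - E` is harmless.

A structural function exists because the distribution function of `|p|` tends to `0` at `0`, by the
nodal set condition, and every such function has a concave majorant vanishing at `0`.
-/

noncomputable section

open scoped Topology

namespace TimeOptimal

section Correlation

variable {E V : Type*} [NormedAddCommGroup E] [NormedSpace ℝ E]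
  [NormedAddCommGroup V] [NormedSpace ℝ V]

lemma exists_continuous_translate {p : ENNReal} [Fact (1 ≤ p)] (hp : p ≠ ⊤) {f : ℝ → E}
    (hf : MemLp f p volume) (S : Set ℝ) :
    ∃ F : ℝ → Lp E p (volume.restrict S), Continuous F ∧
      ∀ r, F r =ᵐ[volume.restrict S] fun s => f (r + s) := by
  have : Fact (p ≠ ⊤) := ⟨hp⟩
  refine ⟨fun r => LpToLpRestrictCLM ℝ E ℝ volume p S (DomAddAct.mk r +ᵥ hf.toLp f),
    (ContinuousLinearMap.continuous _).comp
      (DomAddAct.continuous_mk.vadd continuous_const), fun r => ?_⟩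
  refine (LpToLpRestrictCLM_coeFn ℝ S _).trans (ae_restrict_of_ae ?_)
  rw [DomAddAct.mk_vadd_toLp]
  exact MemLp.coeFn_toLp _

/-- The correlation `∫_S f(r + s) g(c + s) ds` of an operator-valued and a vector-valued function
with independent shifts. -/
def correlation (S : Set ℝ) (f : ℝ → V →L[ℝ] E) (g : ℝ → V) (r c : ℝ) : E :=
  ∫ s in S, f (r + s) (g (c + s))

variable {f : ℝ → V →L[ℝ] E} {g : ℝ → V}

lemma continuous_correlation [CompleteSpace E] (hf : MemLp f 2 volume) (hg : MemLp g 2 volume)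
    (S : Set ℝ) : Continuous (Function.uncurry (correlation S f g)) := by
  obtain ⟨F, hFc, hF⟩ := exists_continuous_translate ENNReal.ofNat_ne_top hf S
  obtain ⟨K, hKc, hK⟩ := exists_continuous_translate ENNReal.ofNat_ne_top hg S
  let pairing := (ContinuousLinearMap.id ℝ (V →L[ℝ] E)).lpPairing (volume.restrict S) 2 2
  have hpairing : Function.uncurry (correlation S f g) = fun x => pairing (F x.1) (K x.2) := by
    funext ⟨r, c⟩
    refine Eq.trans ?_ (ContinuousLinearMap.lpPairing_eq_integral _ _ _).symm
    refine integral_congr_ae ?_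
    filter_upwards [hF r, hK c] with s hFs hKs
    rw [hFs, hKs, ContinuousLinearMap.id_apply]
  rw [hpairing]
  exact (pairing.continuous.comp (hFc.comp continuous_fst)).clm_apply (hKc.comp continuous_snd)

lemma integrable_shear (hf : MemLp f 2 volume) (hg : MemLp g 2 volume) (S T : Set ℝ)
    [IsFiniteMeasure (volume.restrict T)] (c : ℝ) :
    Integrable (fun z : ℝ × ℝ => f (z.1 + z.2) (g (c + z.2)))
      ((volume.restrict T).prod (volume.restrict S)) := by
  have hf' : MemLp (fun z : ℝ × ℝ => f (z.1 + z.2)) 2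
      ((volume.restrict T).prod (volume.restrict S)) :=
    ((hf.comp_snd (volume.restrict T)).comp_measurePreserving
      (measurePreserving_prod_add _ _)).mono_measure
        (Measure.prod_mono le_rfl Measure.restrict_le_self)
  have hg' : MemLp (fun z : ℝ × ℝ => g (c + z.2)) 2
      ((volume.restrict T).prod (volume.restrict S)) :=
    ((hg.comp_measurePreserving (measurePreserving_add_left volume c)).restrict S).comp_snd _
  exact memLp_one_iff_integrable.mp
    ((ContinuousLinearMap.id ℝ (V →L[ℝ] E)).memLp_of_bilin 1 hf' hg')

lemma integral_correlation (hf : MemLp f 2 volume) (hg : MemLp g 2 volume) (S T : Set ℝ)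
    [IsFiniteMeasure (volume.restrict T)] (c : ℝ) :
    ∫ r in T, correlation S f g r c = ∫ s in S, ∫ r in T, f (r + s) (g (c + s)) :=
  integral_integral_swap (integrable_shear hf hg S T c)

lemma tendsto_average_zero [CompleteSpace E] {K : ℝ → ℝ → E}
    (hK : Continuous (Function.uncurry K)) :
    Tendsto (fun h : ℝ => h⁻¹ • ∫ r in (0 : ℝ)..h, K h r) (𝓝[>] 0) (𝓝 (K 0 0)) := by
  have hscaled : Continuous fun h : ℝ => ∫ θ in (0 : ℝ)..1, K h (h * θ) :=
    intervalIntegral.continuous_parametric_intervalIntegral_of_continuous' (by fun_prop) 0 1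
  have hlim := (hscaled.tendsto 0).mono_left (nhdsWithin_le_nhds (s := Ioi 0))
  simp only [zero_mul, intervalIntegral.integral_const, sub_zero, one_smul] at hlim
  refine hlim.congr' ?_
  filter_upwards [self_mem_nhdsWithin] with h hh
  have hscale := intervalIntegral.smul_integral_comp_mul_left (a := 0) (b := 1) (K h) h
  rw [mul_zero, mul_one] at hscale
  rw [← hscale, inv_smul_smul₀ (mem_Ioi.mp hh).ne']

end Correlation

section Evolution

variable {V H : Type*} [NormedAddCommGroup V] [NormedSpace ℝ V]
  [NormedAddCommGroup H] [InnerProductSpace ℝ H]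

/-- A trajectory in the Gelfand triple `V → H → V*` over `[a, b]`: `u ∈ C([a, b]; H)` is the
continuous representative of `U ∈ L²(a, b; V)`, and `f ∈ L²(a, b; V*)` is its time derivative,
expressed by the fundamental theorem of calculus tested against each `φ ∈ V`. -/
structure IsEvolution (a b : ℝ) (j : V →L[ℝ] H) (u : ℝ → H) (U : ℝ → V)
    (f : ℝ → StrongDual ℝ V) : Prop where
  continuousOn : ContinuousOn u (Icc a b)
  memLp_val : MemLp U 2 (volume.restrict (Ioo a b))
  memLp_dt : MemLp f 2 (volume.restrict (Ioo a b))
  ae_eq : ∀ᵐ t ∂volume.restrict (Ioo a b), j (U t) = u t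
  primitive : ∀ t ∈ Icc a b, ∀ φ, ⟪u t, j φ⟫_ℝ = ⟪u a, j φ⟫_ℝ + ∫ s in a..t, f s φ

lemma integral_window_sub {Φ : ℝ → ℝ} (hΦ : Continuous Φ) (a t h : ℝ) :
    ∫ r in (0 : ℝ)..h, (Φ (t + r) - Φ (a + r)) = ∫ s in a..t, (Φ (h + s) - Φ s) := by
  have hint (c d : ℝ) : IntervalIntegrable Φ volume c d := hΦ.intervalIntegrable c d
  have hshift (e c d : ℝ) : IntervalIntegrable (fun r => Φ (e + r)) volume c d :=
    (hΦ.comp (continuous_const.add continuous_id)).intervalIntegrable c d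
  rw [intervalIntegral.integral_sub (hshift _ _ _) (hshift _ _ _),
    intervalIntegral.integral_sub (hshift _ _ _) (hint _ _),
    intervalIntegral.integral_comp_add_left, intervalIntegral.integral_comp_add_left,
    intervalIntegral.integral_comp_add_left, add_zero, add_zero, add_comm h a, add_comm h t]
  exact intervalIntegral.integral_interval_sub_interval_comm'
    (hint t (t + h)) (hint a (a + h)) (hint t a)

lemma intervalIntegrable_of_memLp_two {E : Type*} [NormedAddCommGroup E] {a b s t : ℝ} {f : ℝ → E}
    (hf : MemLp f 2 (volume.restrict (Ioo a b))) (hs : s ∈ Icc a b) (ht : t ∈ Icc a b) :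
    IntervalIntegrable f volume s t := by
  have hf' : IntegrableOn f (Icc a b) := by
    rw [integrableOn_Icc_iff_integrableOn_Ioo]
    exact hf.integrable one_le_two
  exact (hf'.mono_set (uIcc_subset_Icc hs ht)).intervalIntegrable

namespace IsEvolution

variable {a b : ℝ} {j : V →L[ℝ] H} {u v : ℝ → H} {U Y : ℝ → V} {f g : ℝ → StrongDual ℝ V}

lemma intervalIntegrable_dt_apply (hu : IsEvolution a b j u U f) {s t : ℝ} (hs : s ∈ Icc a b)
    (ht : t ∈ Icc a b) (φ : V) : IntervalIntegrable (fun r => f r φ) volume s t :=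
  intervalIntegrable_of_memLp_two
    ((ContinuousLinearMap.apply ℝ ℝ φ).comp_memLp' hu.memLp_dt) hs ht

lemma sub (hu : IsEvolution a b j u U f) (hv : IsEvolution a b j v Y g) :
    IsEvolution a b j (u - v) (U - Y) (f - g) where
  continuousOn := hu.continuousOn.sub hv.continuousOn
  memLp_val := hu.memLp_val.sub hv.memLp_val
  memLp_dt := hu.memLp_dt.sub hv.memLp_dt
  ae_eq := by
    filter_upwards [hu.ae_eq, hv.ae_eq] with t hut hvt
    rw [Pi.sub_apply, Pi.sub_apply, map_sub, hut, hvt]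
  primitive t ht φ := by
    have ha : a ∈ Icc a b := ⟨le_rfl, ht.1.trans ht.2⟩
    simp only [Pi.sub_apply, inner_sub_left, sub_apply]
    rw [intervalIntegral.integral_sub (hu.intervalIntegrable_dt_apply ha ht φ)
      (hv.intervalIntegrable_dt_apply ha ht φ), hu.primitive t ht, hv.primitive t ht]
    ring

lemma inner_sub (hu : IsEvolution a b j u U f) {s t : ℝ} (hs : s ∈ Icc a b) (ht : t ∈ Icc a b)
    (φ : V) : ⟪u t - u s, j φ⟫_ℝ = ∫ r in s..t, f r φ := by
  have ha : a ∈ Icc a b := ⟨le_rfl, hs.1.trans hs.2⟩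
  rw [inner_sub_left, hu.primitive t ht, hu.primitive s hs, add_sub_add_left_eq_sub,
    intervalIntegral.integral_interval_sub_left (hu.intervalIntegrable_dt_apply ha ht φ)
      (hu.intervalIntegrable_dt_apply ha hs φ)]

lemma memLp_indicator_dt (hu : IsEvolution a b j u U f) :
    MemLp ((Ioo a b).indicator f) 2 volume :=
  (memLp_indicator_iff_restrict (ε := StrongDual ℝ V) (f := f) measurableSet_Ioo).mpr hu.memLp_dt

lemma memLp_indicator_val (hu : IsEvolution a b j u U f) :
    MemLp ((Ioo a b).indicator U) 2 volume :=
  (memLp_indicator_iff_restrict measurableSet_Ioo).mpr hu.memLp_val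

lemma ae_inner_increment (hu : IsEvolution a b j u U f) (hv : IsEvolution a b j v Y g)
    {t h c : ℝ} (ht : t + h ≤ b) (hc : c ∈ Icc 0 h) :
    ∀ᵐ s ∂volume.restrict (Ioo a t), ⟪u (h + s) - u s, v (c + s)⟫_ℝ =
      ∫ r in Ioc 0 h, (Ioo a b).indicator f (r + s) ((Ioo a b).indicator Y (c + s)) := by
  have hvshift : ∀ᵐ s, c + s ∈ Ioo a b → j (Y (c + s)) = v (c + s) :=
    (measurePreserving_add_left volume c).quasiMeasurePreserving.ae
      ((ae_restrict_iff' measurableSet_Ioo).mp hv.ae_eq)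
  rw [ae_restrict_iff' measurableSet_Ioo]
  filter_upwards [hvshift] with s hvs ⟨has, hst⟩
  have hcs : c + s ∈ Ioo a b := ⟨by linarith [hc.1], by linarith [hc.2]⟩
  have hh : 0 ≤ h := hc.1.trans hc.2
  rw [← hvs hcs, hu.inner_sub ⟨has.le, by linarith⟩ ⟨by linarith, by linarith⟩,
    indicator_of_mem hcs, ← intervalIntegral.integral_of_le hh]
  have hsub := intervalIntegral.integral_comp_add_right (a := 0) (b := h)
    (fun r => f r (Y (c + s))) s
  rw [zero_add] at hsub
  rw [← hsub, intervalIntegral.integral_of_le hh, intervalIntegral.integral_of_le hh]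
  refine setIntegral_congr_fun measurableSet_Ioc fun r hr => ?_
  rw [indicator_of_mem (show r + s ∈ Ioo a b from ⟨by linarith [hr.1], by linarith [hr.2]⟩)]

lemma integral_inner_increment (hu : IsEvolution a b j u U f) (hv : IsEvolution a b j v Y g)
    {t h c : ℝ} (ht : t + h ≤ b) (hc : c ∈ Icc 0 h) :
    ∫ s in Ioo a t, ⟪u (h + s) - u s, v (c + s)⟫_ℝ =
      ∫ r in (0 : ℝ)..h,
        correlation (Ioo a t) ((Ioo a b).indicator f) ((Ioo a b).indicator Y) r c := by
  rw [intervalIntegral.integral_of_le (hc.1.trans hc.2),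
    integral_correlation hu.memLp_indicator_dt hv.memLp_indicator_val]
  exact integral_congr_ae (hu.ae_inner_increment hv ht hc)

lemma integrableOn_inner_increment (hu : IsEvolution a b j u U f)
    (hv : IsEvolution a b j v Y g) {t h c : ℝ} (ht : t + h ≤ b) (hc : c ∈ Icc 0 h) :
    IntegrableOn (fun s => ⟪u (h + s) - u s, v (c + s)⟫_ℝ) (Ioo a t) := by
  have hmaps {e : ℝ} (he : e ∈ Icc 0 h) : MapsTo (fun s => e + s) (Icc a t) (Icc a b) :=
    fun s hs => ⟨by linarith [he.1, hs.1], by linarith [he.2, hs.2]⟩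
  have hh : 0 ≤ h := hc.1.trans hc.2
  have hcont : ContinuousOn (fun s => ⟪u (h + s) - u s, v (c + s)⟫_ℝ) (Icc a t) :=
    ((hu.continuousOn.comp (by fun_prop) (hmaps ⟨hh, le_rfl⟩)).sub
      (hu.continuousOn.mono (Icc_subset_Icc_right (by linarith)))).inner
      (hv.continuousOn.comp (by fun_prop) (hmaps hc))
  exact hcont.integrableOn_Icc.mono_set Ioo_subset_Icc_self

lemma correlation_indicator_zero {t : ℝ} (ht : t ∈ Icc a b) :
    correlation (Ioo a t) ((Ioo a b).indicator f) ((Ioo a b).indicator Y) 0 0 =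
      ∫ s in a..t, f s (Y s) := by
  rw [intervalIntegral.integral_of_le ht.1, integral_Ioc_eq_integral_Ioo]
  refine setIntegral_congr_fun measurableSet_Ioo fun s hs => ?_
  have hs' : s ∈ Ioo a b := ⟨hs.1, hs.2.trans_le ht.2⟩
  simp only [zero_add, indicator_of_mem hs']

lemma intervalIntegrable_dt_val (hu : IsEvolution a b j u U f) (hv : IsEvolution a b j v Y g)
    {s t : ℝ} (hs : s ∈ Icc a b) (ht : t ∈ Icc a b) :
    IntervalIntegrable (fun r => f r (Y r)) volume s t := by
  have hint : IntegrableOn (fun r => f r (Y r)) (Icc a b) := by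
    rw [integrableOn_Icc_iff_integrableOn_Ioo]
    exact memLp_one_iff_integrable.mp
      ((ContinuousLinearMap.id ℝ (StrongDual ℝ V)).memLp_of_bilin 1 hu.memLp_dt hv.memLp_val)
  exact (hint.mono_set (uIcc_subset_Icc hs ht)).intervalIntegrable

lemma integral_window_inner_sub (hu : IsEvolution a b j u U f) (hv : IsEvolution a b j v Y g)
    {Φ : ℝ → ℝ} (hΦ : Continuous Φ) (hΦuv : ∀ s ∈ Icc a b, Φ s = ⟪u s, v s⟫_ℝ)
    {t h : ℝ} (hat : a ≤ t) (hh : 0 ≤ h) (ht : t + h ≤ b) :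
    ∫ r in (0 : ℝ)..h, (Φ (t + r) - Φ (a + r)) = ∫ r in (0 : ℝ)..h,
      (correlation (Ioo a t) ((Ioo a b).indicator f) ((Ioo a b).indicator Y) r h +
        correlation (Ioo a t) ((Ioo a b).indicator g) ((Ioo a b).indicator U) r 0) := by
  have hint {f' : ℝ → StrongDual ℝ V} {g' : ℝ → V} (hf' : MemLp f' 2 volume)
      (hg' : MemLp g' 2 volume) (c : ℝ) :
      IntervalIntegrable (fun r => correlation (Ioo a t) f' g' r c) volume 0 h :=
    ((continuous_correlation hf' hg' _).comp (Continuous.prodMk_left c)).intervalIntegrable 0 h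
  have h0 : (0 : ℝ) ∈ Icc 0 h := ⟨le_rfl, hh⟩
  have hh' : h ∈ Icc 0 h := ⟨hh, le_rfl⟩
  rw [integral_window_sub hΦ, intervalIntegral.integral_add
      (hint hu.memLp_indicator_dt hv.memLp_indicator_val h)
      (hint hv.memLp_indicator_dt hu.memLp_indicator_val 0),
    ← hu.integral_inner_increment hv ht hh', ← hv.integral_inner_increment hu ht h0,
    intervalIntegral.integral_of_le hat, integral_Ioc_eq_integral_Ioo,
    ← integral_add (hu.integrableOn_inner_increment hv ht hh')
      (hv.integrableOn_inner_increment hu ht h0)]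
  refine setIntegral_congr_fun measurableSet_Ioo fun s hs => ?_
  simp only [hΦuv s ⟨hs.1.le, by linarith [hs.2]⟩,
    hΦuv (h + s) ⟨by linarith [hs.1], by linarith [hs.2]⟩, zero_add, inner_sub_left,
    real_inner_comm (u s), inner_sub_right]
  ring

-- The product rule, by averaging the increments of `⟪u, v⟫` over windows of length `h`: translation
-- is continuous in `L²`, so the averages converge as `h → 0`.
lemma inner_eq_add_integral_of_lt (hu : IsEvolution a b j u U f) (hv : IsEvolution a b j v Y g)
    {t : ℝ} (ht : t ∈ Ico a b) :
    ⟪u t, v t⟫_ℝ = ⟪u a, v a⟫_ℝ + ∫ s in a..t, (f s (Y s) + g s (U s)) := by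
  let Φ : ℝ → ℝ := IccExtend (ht.1.trans ht.2.le) ((Icc a b).domRestrict fun s => ⟪u s, v s⟫_ℝ)
  have hΦ : Continuous Φ :=
    (hu.continuousOn.inner hv.continuousOn).domRestrict.Icc_extend'
  have hΦuv : ∀ s ∈ Icc a b, Φ s = ⟪u s, v s⟫_ℝ := fun s hs => IccExtend_of_mem _ _ hs
  let corr (h r : ℝ) : ℝ :=
    correlation (Ioo a t) ((Ioo a b).indicator f) ((Ioo a b).indicator Y) r h +
      correlation (Ioo a t) ((Ioo a b).indicator g) ((Ioo a b).indicator U) r 0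
  have hcorr : Continuous (Function.uncurry corr) :=
    ((continuous_correlation hu.memLp_indicator_dt hv.memLp_indicator_val _).comp
      continuous_swap).add
    ((continuous_correlation hv.memLp_indicator_dt hu.memLp_indicator_val _).comp
      ((Continuous.prodMk_left 0).comp continuous_snd))
  have hwindow : ∀ᶠ h in 𝓝[>] (0 : ℝ), h⁻¹ • ∫ r in (0 : ℝ)..h, corr h r =
      h⁻¹ • ∫ r in (0 : ℝ)..h, (Φ (t + r) - Φ (a + r)) := by
    filter_upwards [Ioo_mem_nhdsGT (sub_pos.mpr ht.2)] with h hh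
    rw [hu.integral_window_inner_sub hv hΦ hΦuv ht.1 hh.1.le (by linarith [hh.2])]
  have hlim : corr 0 0 = Φ (t + 0) - Φ (a + 0) :=
    tendsto_nhds_unique ((tendsto_average_zero hcorr).congr' hwindow)
      (tendsto_average_zero (K := fun _ r => Φ (t + r) - Φ (a + r)) (by fun_prop))
  have ha : a ∈ Icc a b := ⟨le_rfl, ht.1.trans ht.2.le⟩
  have ht' : t ∈ Icc a b := ⟨ht.1, ht.2.le⟩
  rw [add_zero, add_zero, hΦuv t ht', hΦuv a ha] at hlim
  rw [intervalIntegral.integral_add (hu.intervalIntegrable_dt_val hv ha ht')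
      (hv.intervalIntegrable_dt_val hu ha ht'), ← correlation_indicator_zero ht',
    ← correlation_indicator_zero ht']
  exact eq_add_of_sub_eq' hlim.symm

theorem inner_eq_add_integral (hu : IsEvolution a b j u U f) (hv : IsEvolution a b j v Y g)
    {t : ℝ} (ht : t ∈ Icc a b) :
    ⟪u t, v t⟫_ℝ = ⟪u a, v a⟫_ℝ + ∫ s in a..t, (f s (Y s) + g s (U s)) := by
  rcases ht.1.eq_or_lt with rfl | hat
  · simp
  have hab : a < b := hat.trans_le ht.2
  have ha : a ∈ Icc a b := ⟨le_rfl, hab.le⟩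
  have hb : b ∈ Icc a b := ⟨hab.le, le_rfl⟩
  have hprimitive : ContinuousOn (fun t => ∫ s in a..t, (f s (Y s) + g s (U s))) (Icc a b) := by
    rw [← uIcc_of_le hab.le]
    exact intervalIntegral.continuousOn_primitive_interval'
      ((hu.intervalIntegrable_dt_val hv ha hb).add (hv.intervalIntegrable_dt_val hu ha hb))
      left_mem_uIcc
  refine EqOn.of_subset_closure (s := Ico a b) (fun t ht => hu.inner_eq_add_integral_of_lt hv ht)
    (hu.continuousOn.inner hv.continuousOn) (continuousOn_const.add hprimitive)
    Ico_subset_Icc_self (closure_Ico hab.ne).ge ht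

end IsEvolution

end Evolution

section EnergyEstimate

variable {V H : Type*} [NormedAddCommGroup V] [NormedSpace ℝ V]
  [NormedAddCommGroup H] [InnerProductSpace ℝ H]

lemma inner_le_mul_sq_add_inv_mul_sq {c : ℝ} (hc : 0 < c) (x y : H) :
    ⟪x, y⟫_ℝ ≤ c * ‖x‖ ^ 2 + (4 * c)⁻¹ * ‖y‖ ^ 2 := by
  refine (real_inner_le_norm x y).trans ?_
  have hsq : 0 ≤ (4 * c)⁻¹ * (2 * c * ‖x‖ - ‖y‖) ^ 2 := by positivity
  have hexpand : (4 * c)⁻¹ * (2 * c * ‖x‖ - ‖y‖) ^ 2 =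
      c * ‖x‖ ^ 2 + (4 * c)⁻¹ * ‖y‖ ^ 2 - ‖x‖ * ‖y‖ := by
    field_simp
    ring
  linarith

namespace IsEvolution

variable {a b : ℝ} {j : V →L[ℝ] H} {u : ℝ → H} {U : ℝ → V} {f : ℝ → StrongDual ℝ V}

lemma norm_sq_eq (hu : IsEvolution a b j u U f) (hua : u a = 0) {t : ℝ} (ht : t ∈ Icc a b) :
    ‖u t‖ ^ 2 = 2 * ∫ s in a..t, f s (U s) := by
  rw [← real_inner_self_eq_norm_sq, hu.inner_eq_add_integral hu ht, hua, inner_zero_left,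
    zero_add, ← intervalIntegral.integral_const_mul]
  simp only [two_mul]

lemma norm_sq_add_le (hu : IsEvolution a b j u U f) (hua : u a = 0) {α β : ℝ → ℝ}
    (hα : IntegrableOn α (Ioo a b)) (hβ : IntegrableOn β (Ioo a b)) (hβ0 : ∀ t, 0 ≤ β t)
    {κ M : ℝ} (hκ : 0 ≤ κ) (hM : ∀ t ∈ Icc a b, ‖u t‖ ^ 2 ≤ M)
    (hdiss : ∀ᵐ t ∂volume.restrict (Ioo a b), f t (U t) ≤ -α t + β t + κ * ‖u t‖ ^ 2)
    {t : ℝ} (ht : t ∈ Icc a b) :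
    ‖u t‖ ^ 2 + 2 * (∫ s in Ioo a t, α s) ≤
      2 * (∫ s in Ioo a b, β s) + 2 * (κ * (b - a) * M) := by
  have ha : a ∈ Icc a b := ⟨le_rfl, ht.1.trans ht.2⟩
  have hsub : Ioo a t ⊆ Ioo a b := Ioo_subset_Ioo_right ht.2
  have hαt := hα.mono_set hsub
  have hβt := hβ.mono_set hsub
  have hnegα : IntegrableOn (fun s => -α s) (Ioo a t) := hαt.neg
  have hαβ : IntegrableOn (fun s => -α s + β s) (Ioo a t) := hnegα.add hβt
  have hpower : IntegrableOn (fun s => f s (U s)) (Ioo a t) :=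
    ((intervalIntegrable_iff_integrableOn_Ioo_of_le ht.1).mp
      (hu.intervalIntegrable_dt_val hu ha ht))
  have hbound : ∫ s in Ioo a t, f s (U s) ≤ ∫ s in Ioo a t, (-α s + β s + κ * M) := by
    refine integral_mono_ae hpower (hαβ.add (integrable_const _)) ?_
    filter_upwards [ae_restrict_of_ae_restrict_of_subset hsub hdiss,
      ae_restrict_mem measurableSet_Ioo] with s hs hst
    have := mul_le_mul_of_nonneg_left (hM s (Ioo_subset_Icc_self (hsub hst))) hκ
    linarith
  have hsplit : ∫ s in Ioo a t, (-α s + β s + κ * M) =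
      -(∫ s in Ioo a t, α s) + (∫ s in Ioo a t, β s) + (t - a) * (κ * M) := by
    rw [integral_add hαβ (integrable_const _), integral_add hnegα hβt, integral_neg,
      setIntegral_const, Real.volume_real_Ioo_of_le ht.1, smul_eq_mul]
  have hβmono : ∫ s in Ioo a t, β s ≤ ∫ s in Ioo a b, β s :=
    setIntegral_mono_set hβ (ae_of_all _ hβ0) hsub.eventuallyLE
  have hM0 : 0 ≤ M := (sq_nonneg _).trans (hM a ha)
  have hlength : (t - a) * (κ * M) ≤ (b - a) * (κ * M) := by gcongr; exact ht.2
  rw [hu.norm_sq_eq hua ht, intervalIntegral.integral_of_le ht.1, integral_Ioc_eq_integral_Ioo]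
  linarith

-- Evaluating the estimate where `‖u‖` is maximal absorbs the `κ`-term into the left-hand side.
lemma integral_dissipation_le (hu : IsEvolution a b j u U f) (hab : a ≤ b) (hua : u a = 0)
    {α β : ℝ → ℝ} (hα : IntegrableOn α (Ioo a b)) (hβ : IntegrableOn β (Ioo a b))
    (hα0 : ∀ t, 0 ≤ α t) (hβ0 : ∀ t, 0 ≤ β t)
    {κ : ℝ} (hκ : 0 ≤ κ) (hκab : κ * (b - a) ≤ 1 / 4)
    (hdiss : ∀ᵐ t ∂volume.restrict (Ioo a b), f t (U t) ≤ -α t + β t + κ * ‖u t‖ ^ 2) :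
    ∫ t in Ioo a b, α t ≤ 2 * ∫ t in Ioo a b, β t := by
  obtain ⟨τ, hτ, hmax⟩ := isCompact_Icc.exists_isMaxOn ⟨a, le_rfl, hab⟩ hu.continuousOn.norm
  have hM : ∀ t ∈ Icc a b, ‖u t‖ ^ 2 ≤ ‖u τ‖ ^ 2 := fun t ht =>
    pow_le_pow_left₀ (norm_nonneg _) (hmax ht) 2
  have hest {t : ℝ} (ht : t ∈ Icc a b) := hu.norm_sq_add_le hua hα hβ hβ0 hκ hM hdiss ht
  have hτα : 0 ≤ ∫ s in Ioo a τ, α s := integral_nonneg hα0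
  have hκM : κ * (b - a) * ‖u τ‖ ^ 2 ≤ 1 / 4 * ‖u τ‖ ^ 2 := by gcongr
  linarith [hest hτ, hest ⟨hab, le_rfl⟩, sq_nonneg ‖u b‖]

variable {F : Type*} [NormedAddCommGroup F] [InnerProductSpace ℝ F]

theorem integral_norm_sq_le_of_source (hu : IsEvolution a b j u U f) (hab : a < b) (hua : u a = 0)
    {D : V →L[ℝ] F} {ν : ℝ} (hν : 0 < ν) {g : ℝ → H} {γ : ℝ → ℝ} {k : ℝ → F}
    (hγ : IntegrableOn γ (Ioo a b)) (hgγ : ∀ t, ‖g t‖ ^ 2 ≤ γ t)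
    (hk : MemLp k 2 (volume.restrict (Ioo a b)))
    (hf : ∀ᵐ t ∂volume.restrict (Ioo a b), ∀ φ, f t φ =
      -ν * ⟪D (U t), D φ⟫_ℝ + ⟪g t, j φ⟫_ℝ + ⟪k t, D φ⟫_ℝ) :
    ν * ∫ t in Ioo a b, ‖D (U t)‖ ^ 2 ≤
      4 * (b - a) * (∫ t in Ioo a b, γ t) + 2 / ν * ∫ t in Ioo a b, ‖k t‖ ^ 2 := by
  have hba : 0 < b - a := sub_pos.mpr hab
  have hDU : IntegrableOn (fun t => ‖D (U t)‖ ^ 2) (Ioo a b) :=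
    (hu.memLp_val.continuousLinearMap_comp D).integrable_norm_pow two_ne_zero
  have hkk : IntegrableOn (fun t => ‖k t‖ ^ 2) (Ioo a b) := hk.integrable_norm_pow two_ne_zero
  have hβ : IntegrableOn (fun t => (b - a) * γ t + (2 * ν)⁻¹ * ‖k t‖ ^ 2) (Ioo a b) :=
    (hγ.const_mul _).add (hkk.const_mul _)
  have hβ0 (t : ℝ) : 0 ≤ (b - a) * γ t + (2 * ν)⁻¹ * ‖k t‖ ^ 2 := by
    have hγ0 := (sq_nonneg _).trans (hgγ t)
    positivity
  have hmain := hu.integral_dissipation_le hab.le hua (κ := (4 * (b - a))⁻¹)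
    (hDU.const_mul (ν / 2)) hβ (fun t => by positivity) hβ0 (by positivity)
    (by field_simp; norm_num) ?_
  · rw [integral_add (hγ.const_mul _) (hkk.const_mul _), integral_const_mul, integral_const_mul,
      integral_const_mul] at hmain
    have hexpand : 2 / ν * (∫ t in Ioo a b, ‖k t‖ ^ 2) =
        4 * ((2 * ν)⁻¹ * ∫ t in Ioo a b, ‖k t‖ ^ 2) := by
      field_simp
      ring
    linarith
  · filter_upwards [hf, hu.ae_eq] with t hft hut
    rw [hft (U t), hut, real_inner_self_eq_norm_sq]
    have hyoung_g := inner_le_mul_sq_add_inv_mul_sq hba (g t) (u t)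
    have hyoung_k := inner_le_mul_sq_add_inv_mul_sq (inv_pos.mpr (mul_pos two_pos hν)) (k t)
      (D (U t))
    have hgγt := mul_le_mul_of_nonneg_left (hgγ t) hba.le
    have hcoef : (4 * (2 * ν)⁻¹)⁻¹ = ν / 2 := by
      field_simp
      norm_num
    rw [hcoef] at hyoung_k
    linarith

end IsEvolution

end EnergyEstimate

section LinearFunctional

variable {α : Type*} [MeasurableSpace α] {μ : Measure α}

lemma inner_sub_eq_integral_mul (p q r : Lp ℝ 2 μ) :
    ⟪p, q - r⟫_ℝ = ∫ y, p y * (q y - r y) ∂μ := by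
  rw [L2.inner_def]
  refine integral_congr_ae ?_
  filter_upwards [Lp.coeFn_sub q r] with y hy
  rw [hy, Pi.sub_apply, real_inner_eq_re_inner, RCLike.inner_apply, conj_trivial]
  exact mul_comm _ _

lemma integrable_mul_sub (p q r : Lp ℝ 2 μ) : Integrable (fun y => p y * (q y - r y)) μ :=
  (Lp.memLp p).integrable_mul ((Lp.memLp q).sub (Lp.memLp r))

open Classical in
-- The competitor that equals `q` on a set `S` and `r` elsewhere localizes the inequality to `S`.
lemma ae_nonneg_mul_sub_of_forall_inner_nonneg {p q r : Lp ℝ 2 μ} {a b : ℝ}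
    (hmin : ∀ q : Lp ℝ 2 μ, (∀ᵐ y ∂μ, q y ∈ Icc a b) → 0 ≤ ⟪p, q - r⟫_ℝ)
    (hq : ∀ᵐ y ∂μ, q y ∈ Icc a b) (hr : ∀ᵐ y ∂μ, r y ∈ Icc a b) :
    ∀ᵐ y ∂μ, 0 ≤ p y * (q y - r y) := by
  refine ae_nonneg_of_forall_setIntegral_nonneg (integrable_mul_sub p q r) fun S hS _ => ?_
  have hmem : MemLp (S.piecewise q r) 2 μ :=
    MemLp.piecewise hS ((Lp.memLp q).restrict S) ((Lp.memLp r).restrict Sᶜ)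
  have hfeasible : ∀ᵐ y ∂μ, hmem.toLp _ y ∈ Icc a b := by
    filter_upwards [hmem.coeFn_toLp, hq, hr] with y hy hqy hry
    rw [hy]
    by_cases hyS : y ∈ S <;> simpa only [piecewise, hyS, if_true, if_false]
  refine (hmin _ hfeasible).trans_eq ?_
  rw [inner_sub_eq_integral_mul, ← integral_indicator hS]
  refine integral_congr_ae ?_
  filter_upwards [hmem.coeFn_toLp] with y hy
  by_cases hyS : y ∈ S <;> simp [hy, hyS]

variable [IsFiniteMeasure μ]

lemma mul_integral_abs_sub_le_integral_mul_abs {p f : α → ℝ} {M ε : ℝ} (hp : Measurable p)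
    (hf : Integrable f μ) (hpf : Integrable (fun y => |p y| * |f y|) μ)
    (hM : ∀ᵐ y ∂μ, |f y| ≤ M) (hε : 0 ≤ ε) :
    ε * ((∫ y, |f y| ∂μ) - μ.real {y | -ε ≤ p y ∧ p y ≤ ε} * M) ≤ ∫ y, |p y| * |f y| ∂μ := by
  set S := {y | -ε ≤ p y ∧ p y ≤ ε}
  have hS : MeasurableSet S :=
    (measurableSet_le measurable_const hp).inter (measurableSet_le hp measurable_const)
  have hMS : Integrable (S.indicator fun _ => M) μ := (integrable_const M).indicator hS
  rw [← smul_eq_mul (μ.real S), ← integral_indicator_const M hS, ← integral_sub hf.abs hMS,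
    ← integral_const_mul]
  refine integral_mono_ae ((hf.abs.sub hMS).const_mul ε) hpf ?_
  filter_upwards [hM] with y hy
  by_cases hyS : y ∈ S
  · rw [indicator_of_mem hyS]
    exact (mul_nonpos_of_nonneg_of_nonpos hε (sub_nonpos.mpr hy)).trans (by positivity)
  · rw [indicator_of_notMem hyS, sub_zero]
    have hεp : ε ≤ |p y| := (not_le.mp fun hle => hyS (abs_le.mp hle)).le
    gcongr

end LinearFunctional

section LevelMajorant

lemma min_one_div_abs_nonneg {ε : ℝ} (hε : 0 ≤ ε) (x : ℝ) : 0 ≤ min 1 (ε / |x|) :=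
  le_min zero_le_one (div_nonneg hε (abs_nonneg _))

lemma norm_min_one_div_abs_le {ε : ℝ} (hε : 0 ≤ ε) (x : ℝ) : ‖min 1 (ε / |x|)‖ ≤ 1 :=
  (Real.norm_of_nonneg (min_one_div_abs_nonneg hε x)).trans_le (min_le_left _ _)

variable {α : Type*} [MeasurableSpace α] (μ : Measure α) (p : α → ℝ)

/-- A concave majorant of the distribution function `ε ↦ |{|p| ≤ ε}|`: the integrand dominates the
indicator of `{|p| ≤ ε}` wherever `p ≠ 0` (where `p = 0` it is `0`, by the convention
`ε / 0 = 0`), and the added `ε` makes it strictly increasing and unbounded. -/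
def levelMajorant (ε : ℝ) : ℝ := ε + ∫ y, min 1 (ε / |p y|) ∂μ

lemma levelMajorant_zero : levelMajorant μ p 0 = 0 := by simp [levelMajorant]

variable {p}

lemma tendsto_levelMajorant : Tendsto (levelMajorant μ p) atTop atTop := by
  refine tendsto_atTop_mono' _ ?_ tendsto_id
  filter_upwards [eventually_ge_atTop 0] with ε hε
  exact le_add_of_nonneg_right (integral_nonneg fun _ => min_one_div_abs_nonneg hε _)

variable {μ}

lemma measurable_min_one_div_abs (hp : Measurable p) (ε : ℝ) :
    Measurable fun y => min 1 (ε / |p y|) :=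
  measurable_const.min (measurable_const.div hp.abs)

variable [IsFiniteMeasure μ]

lemma integrable_min_one_div_abs (hp : Measurable p) {ε : ℝ} (hε : 0 ≤ ε) :
    Integrable (fun y => min 1 (ε / |p y|)) μ :=
  (integrable_const (1 : ℝ)).mono' (measurable_min_one_div_abs hp ε).aestronglyMeasurable
    (ae_of_all _ fun _ => norm_min_one_div_abs_le hε _)

lemma concaveOn_levelMajorant (hp : Measurable p) :
    ConcaveOn ℝ (Ici 0) (levelMajorant μ p) := by
  refine (concaveOn_id (convex_Ici 0)).add ⟨convex_Ici 0, fun x hx y hy a b ha hb hab => ?_⟩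
  have hx' := (integrable_min_one_div_abs (μ := μ) hp hx).const_mul a
  have hy' := (integrable_min_one_div_abs (μ := μ) hp hy).const_mul b
  simp only [smul_eq_mul]
  rw [← integral_const_mul, ← integral_const_mul, ← integral_add hx' hy']
  refine integral_mono (hx'.add hy')
    (integrable_min_one_div_abs hp (add_nonneg (mul_nonneg ha hx) (mul_nonneg hb hy)))
    fun z => ?_
  dsimp only
  refine le_min ?_ ?_
  · calc a * min 1 (x / |p z|) + b * min 1 (y / |p z|) ≤ a * 1 + b * 1 := by
          gcongr <;> exact min_le_left _ _
      _ = 1 := by rw [mul_one, mul_one, hab]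
  · calc a * min 1 (x / |p z|) + b * min 1 (y / |p z|) ≤ a * (x / |p z|) + b * (y / |p z|) := by
          gcongr <;> exact min_le_right _ _
      _ = (a * x + b * y) / |p z| := by ring

lemma continuousOn_levelMajorant (hp : Measurable p) :
    ContinuousOn (levelMajorant μ p) (Ici 0) :=
  continuousOn_id.add (continuousOn_of_dominated (bound := fun _ => 1)
    (fun ε _ => (measurable_min_one_div_abs hp ε).aestronglyMeasurable)
    (fun _ hε => ae_of_all _ fun _ => norm_min_one_div_abs_le hε _) (integrable_const _)
    (ae_of_all _ fun _ => (continuous_const.min (continuous_id.div_const _)).continuousOn))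

lemma strictMonoOn_levelMajorant (hp : Measurable p) :
    StrictMonoOn (levelMajorant μ p) (Ici 0) := fun a ha b hb hab =>
  add_lt_add_of_lt_of_le hab (integral_mono (integrable_min_one_div_abs hp ha)
    (integrable_min_one_div_abs hp hb) fun y => by dsimp only; gcongr)

lemma measure_level_le_levelMajorant (hp : Measurable p) (hp0 : ∀ᵐ y ∂μ, p y ≠ 0) {ε : ℝ}
    (hε : 0 ≤ ε) :
    μ {y | -ε ≤ p y ∧ p y ≤ ε} ≤ ENNReal.ofReal (levelMajorant μ p ε) := by
  set S := {y | -ε ≤ p y ∧ p y ≤ ε}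
  have hS : MeasurableSet S :=
    (measurableSet_le measurable_const hp).inter (measurableSet_le hp measurable_const)
  rw [← ofReal_measureReal, ← integral_indicator_one hS]
  refine ENNReal.ofReal_le_ofReal (le_add_of_nonneg_of_le hε ?_)
  refine integral_mono_ae ((integrable_const (1 : ℝ)).indicator hS)
    (integrable_min_one_div_abs hp hε) ?_
  filter_upwards [hp0] with y hy
  by_cases hyS : y ∈ S
  · rw [indicator_of_mem hyS, Pi.one_apply]
    exact le_min le_rfl ((one_le_div (abs_pos.mpr hy)).mpr (abs_le.mpr hyS))
  · rw [indicator_of_notMem hyS]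
    exact min_one_div_abs_nonneg hε _

end LevelMajorant

section StructuralFunction

variable {X : Type} [MeasurableSpace X] {ρ : Measure X}

instance : IsProbabilityMeasure timeMeasure := ⟨by simp [timeMeasure]⟩

instance [IsFiniteMeasure ρ] : IsFiniteMeasure (stMeasure ρ) :=
  inferInstanceAs (IsFiniteMeasure (timeMeasure.prod ρ))

lemma exists_isStructuralFunction [IsFiniteMeasure ρ] {p : Q ρ}
    (hnodal : stMeasure ρ {y | p y = 0} = 0) : ∃ Ψ, IsStructuralFunction p Ψ := by
  have hp : Measurable p := (Lp.stronglyMeasurable p).measurable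
  have hp0 : ∀ᵐ y ∂stMeasure ρ, p y ≠ 0 := by simpa [ae_iff] using hnodal
  exact ⟨levelMajorant (stMeasure ρ) p,
    { concave := concaveOn_levelMajorant hp
      continuousOn := continuousOn_levelMajorant hp
      strictMono := strictMonoOn_levelMajorant hp
      zero := levelMajorant_zero _ _
      tendsto := tendsto_levelMajorant _
      measure_le := fun _ hε => measure_level_le_levelMajorant hp hp0 hε.le }⟩

namespace IsStructuralFunction

variable {p : Q ρ} {Ψ : ℝ → ℝ}

lemma exists_eq (hΨ : IsStructuralFunction p Ψ) {y : ℝ} (hy : 0 ≤ y) : ∃ x ∈ Ici 0, Ψ x = y := by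
  obtain ⟨b, hyb, hb⟩ := ((hΨ.tendsto.eventually_ge_atTop y).and (eventually_ge_atTop 0)).exists
  obtain ⟨x, hx, hxy⟩ := intermediate_value_Icc hb (hΨ.continuousOn.mono Icc_subset_Ici_self)
    ⟨hΨ.zero.trans_le hy, hyb⟩
  exact ⟨x, hx.1, hxy⟩

lemma psiInv_nonneg (hΨ : IsStructuralFunction p Ψ) {y : ℝ} (hy : 0 ≤ y) : 0 ≤ psiInv Ψ y :=
  Function.invFunOn_mem (hΨ.exists_eq hy)

lemma apply_psiInv (hΨ : IsStructuralFunction p Ψ) {y : ℝ} (hy : 0 ≤ y) : Ψ (psiInv Ψ y) = y :=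
  Function.invFunOn_eq (hΨ.exists_eq hy)

lemma psiInv_monotoneOn (hΨ : IsStructuralFunction p Ψ) : MonotoneOn (psiInv Ψ) (Ici 0) := by
  intro x hx y hy hxy
  rwa [← hΨ.strictMono.le_iff_le (hΨ.psiInv_nonneg hx) (hΨ.psiInv_nonneg hy),
    hΨ.apply_psiInv hx, hΨ.apply_psiInv hy]

lemma psiInv_pos (hΨ : IsStructuralFunction p Ψ) {y : ℝ} (hy : 0 < y) : 0 < psiInv Ψ y := by
  refine (hΨ.psiInv_nonneg hy.le).lt_of_ne fun h0 => hy.ne ?_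
  rw [← hΨ.apply_psiInv hy.le, ← h0, hΨ.zero]

end IsStructuralFunction

lemma l1Dist_nonneg (q r : Q ρ) : 0 ≤ l1Dist q r := integral_nonneg fun _ => abs_nonneg _

variable {p q r : Q ρ} {qa qb : ℝ}

lemma ae_abs_sub_le_of_mem_Qad (hq : q ∈ Qad ρ qa qb) (hr : r ∈ Qad ρ qa qb) :
    ∀ᵐ y ∂stMeasure ρ, |q y - r y| ≤ qb - qa := by
  filter_upwards [hq, hr] with y hqy hry
  rw [abs_le]
  constructor <;> linarith [hqy.1, hqy.2, hry.1, hry.2]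

variable [IsFiniteMeasure ρ]

lemma integrable_sub (q r : Q ρ) : Integrable (fun y => q y - r y) (stMeasure ρ) :=
  ((Lp.memLp q).sub (Lp.memLp r)).integrable one_le_two

lemma norm_sub_sq_le_mul_l1Dist (hq : q ∈ Qad ρ qa qb) (hr : r ∈ Qad ρ qa qb) :
    ‖q - r‖ ^ 2 ≤ (qb - qa) * l1Dist q r := by
  rw [← real_inner_self_eq_norm_sq, inner_sub_eq_integral_mul, l1Dist, ← integral_const_mul]
  refine integral_mono_ae (integrable_mul_sub _ q r) ((integrable_sub q r).abs.const_mul _) ?_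
  filter_upwards [Lp.coeFn_sub q r, ae_abs_sub_le_of_mem_Qad hq hr] with y hsub hy
  rw [hsub, Pi.sub_apply, ← abs_mul_abs_self]
  gcongr

lemma l1Dist_le_of_mem_Qad (hq : q ∈ Qad ρ qa qb) (hr : r ∈ Qad ρ qa qb) :
    l1Dist q r ≤ (stMeasure ρ).real univ * (qb - qa) :=
  (integral_mono_ae (integrable_sub q r).abs (integrable_const (qb - qa))
    (ae_abs_sub_le_of_mem_Qad hq hr)).trans_eq (by simp)

theorem IsStructuralFunction.growth {Ψ : ℝ → ℝ} (hΨ : IsStructuralFunction p Ψ) (hab : qa < qb)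
    (hr : r ∈ Qad ρ qa qb) (hmin : ∀ q ∈ Qad ρ qa qb, 0 ≤ ⟪p, q - r⟫_ℝ) (hq : q ∈ Qad ρ qa qb) :
    1 / 2 * psiInv Ψ ((2 * (qb - qa))⁻¹ * l1Dist q r) * l1Dist q r ≤ ⟪p, q - r⟫_ℝ := by
  rcases (l1Dist_nonneg q r).eq_or_lt with hL | hL
  · rw [← hL, mul_zero]
    exact hmin q hq
  have hwidth : 0 < qb - qa := sub_pos.mpr hab
  have hpos : 0 < (2 * (qb - qa))⁻¹ * l1Dist q r := by positivity
  set ε := psiInv Ψ ((2 * (qb - qa))⁻¹ * l1Dist q r)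
  have hε : 0 < ε := hΨ.psiInv_pos hpos
  have hΨε : Ψ ε = (2 * (qb - qa))⁻¹ * l1Dist q r := hΨ.apply_psiInv hpos.le
  have hlevel : (stMeasure ρ).real {y | -ε ≤ p y ∧ p y ≤ ε} ≤ Ψ ε :=
    ENNReal.toReal_le_of_le_ofReal (hΨε ▸ hpos.le) (hΨ.measure_le ε hε)
  have habs : ∀ᵐ y ∂stMeasure ρ, p y * (q y - r y) = |p y| * |q y - r y| := by
    filter_upwards [ae_nonneg_mul_sub_of_forall_inner_nonneg hmin hq hr] with y hy
    rw [← abs_mul, abs_of_nonneg hy]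
  calc 1 / 2 * ε * l1Dist q r = ε * (l1Dist q r - Ψ ε * (qb - qa)) := by
        rw [hΨε]; field_simp; ring
    _ ≤ ε * (l1Dist q r - (stMeasure ρ).real {y | -ε ≤ p y ∧ p y ≤ ε} * (qb - qa)) := by gcongr
    _ ≤ ∫ y, |p y| * |q y - r y| ∂stMeasure ρ :=
        mul_integral_abs_sub_le_integral_mul_abs (Lp.stronglyMeasurable p).measurable
          (integrable_sub q r) ((integrable_mul_sub p q r).congr habs)
          (ae_abs_sub_le_of_mem_Qad hq hr) hε.le
    _ = ⟪p, q - r⟫_ℝ := by rw [inner_sub_eq_integral_mul, integral_congr_ae habs]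

end StructuralFunction

section Slice

variable {X : Type} [MeasurableSpace X] {ρ : Measure X} {d : ℕ} {Ω : Set (Sp d)}
  {B : Lp ℝ 2 ρ →L[ℝ] L2 Ω} {z : W Ω} {p : Q ρ}

lemma integral_timeMeasure (f : ℝ → ℝ) : ∫ t, f t ∂timeMeasure = ∫ t in (0 : ℝ)..1, f t := by
  rw [timeMeasure, intervalIntegral.integral_of_le zero_le_one, integral_Ioc_eq_integral_Ioo]

lemma IsObservation.ae_inner_slice_eq (hp : IsObservation B z p) (q : Q ρ) : ∀ᵐ t ∂timeMeasure,
    ⟪B (slice q t), toL2 Ω (z.val t)⟫_ℝ = ⟪slice p t, slice q t⟫_ℝ := by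
  filter_upwards [hp, z.path_ae] with t hpt hz
  rw [hpt, ContinuousLinearMap.adjoint_inner_left, hz, real_inner_comm]

variable [SFinite ρ]

lemma ae_memLp_slice (q : Q ρ) : ∀ᵐ t ∂timeMeasure, MemLp (fun x => q (t, x)) 2 ρ := by
  have hq : Integrable (fun y => q y ^ 2) (timeMeasure.prod ρ) := (Lp.memLp q).integrable_sq
  filter_upwards [hq.prod_right_ae] with t ht
  exact (memLp_two_iff_integrable_sq
    ((Lp.stronglyMeasurable q).comp_measurable measurable_prodMk_left).aestronglyMeasurable).2 ht

lemma ae_slice_eq (q : Q ρ) : ∀ᵐ t ∂timeMeasure, slice q t =ᵐ[ρ] fun x => q (t, x) := by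
  filter_upwards [ae_memLp_slice q] with t ht
  rw [slice, dif_pos ht]
  exact ht.coeFn_toLp

lemma ae_slice_sub (q r : Q ρ) : ∀ᵐ t ∂timeMeasure, slice (q - r) t = slice q t - slice r t := by
  filter_upwards [ae_slice_eq (q - r), ae_slice_eq q, ae_slice_eq r,
    Measure.ae_ae_of_ae_prod (Lp.coeFn_sub q r)] with t hqr hq hr hsub
  refine Lp.ext ?_
  filter_upwards [hqr, hq, hr, hsub, Lp.coeFn_sub (slice q t) (slice r t)]
    with x hqrx hqx hrx hsubx hslice
  rw [hslice, hqrx, hsubx, Pi.sub_apply, Pi.sub_apply, hqx, hrx]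

lemma ae_slice_smul (c : ℝ) (q : Q ρ) : ∀ᵐ t ∂timeMeasure, slice (c • q) t = c • slice q t := by
  filter_upwards [ae_slice_eq (c • q), ae_slice_eq q,
    Measure.ae_ae_of_ae_prod (Lp.coeFn_smul c q)] with t hcq hq hsmul
  refine Lp.ext ?_
  filter_upwards [hcq, hq, hsmul, Lp.coeFn_smul c (slice q t)] with x hcqx hqx hsmulx hslice
  rw [hslice, hcqx, hsmulx, Pi.smul_apply, Pi.smul_apply, hqx]

lemma ae_inner_slice (p q : Q ρ) : ∀ᵐ t ∂timeMeasure,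
    ⟪slice p t, slice q t⟫_ℝ = ∫ x, ⟪p (t, x), q (t, x)⟫_ℝ ∂ρ := by
  filter_upwards [ae_slice_eq p, ae_slice_eq q] with t hp hq
  rw [L2.inner_def]
  refine integral_congr_ae ?_
  filter_upwards [hp, hq] with x hpx hqx
  rw [hpx, hqx]

lemma integrable_inner_slice (p q : Q ρ) :
    Integrable (fun t => ⟪slice p t, slice q t⟫_ℝ) timeMeasure :=
  (L2.integrable_inner (𝕜 := ℝ) p q).integral_prod_left.congr
    ((ae_inner_slice p q).mono fun _ => Eq.symm)

lemma integral_inner_slice (p q : Q ρ) :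
    ∫ t, ⟪slice p t, slice q t⟫_ℝ ∂timeMeasure = ⟪p, q⟫_ℝ := by
  rw [integral_congr_ae (ae_inner_slice p q), L2.inner_def]
  exact (integral_prod _ (L2.integrable_inner (𝕜 := ℝ) p q)).symm

lemma integrable_norm_slice_sq (q : Q ρ) :
    Integrable (fun t => ‖slice q t‖ ^ 2) timeMeasure := by
  simpa only [real_inner_self_eq_norm_sq] using integrable_inner_slice q q

lemma integral_norm_slice_sq (q : Q ρ) : ∫ t, ‖slice q t‖ ^ 2 ∂timeMeasure = ‖q‖ ^ 2 := by
  simpa only [real_inner_self_eq_norm_sq] using integral_inner_slice q q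

lemma IsObservation.integral_inner_adjoint_slice_sub (hp : IsObservation B z p) (q r : Q ρ) :
    ∫ t in (0 : ℝ)..1, ⟪ContinuousLinearMap.adjoint B (z.path t), slice q t - slice r t⟫_ℝ =
      ⟪p, q - r⟫_ℝ := by
  rw [← integral_timeMeasure, ← integral_inner_slice]
  refine integral_congr_ae ?_
  filter_upwards [hp, ae_slice_sub q r] with t hpt hsub
  rw [hpt, hsub]

end Slice

section StateEquation

variable {d : ℕ} {Ω : Set (Sp d)}

lemma emb_apply (f : L2 Ω) (φ : H10 Ω) : emb Ω f φ = ⟪f, toL2 Ω φ⟫_ℝ := rfl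

lemma lap_apply (u φ : H10 Ω) : lap Ω u φ = -⟪grad Ω u, grad Ω φ⟫_ℝ := rfl

namespace W

lemma isEvolution (u : W Ω) : IsEvolution 0 1 (toL2 Ω) u.path u.val u.dt where
  continuousOn := u.path_continuousOn
  memLp_val := Lp.memLp _
  memLp_dt := Lp.memLp _
  ae_eq := u.path_ae
  primitive t ht φ := by
    have h := congr($(u.path_primitive t ht) φ)
    rwa [add_apply, emb_apply, emb_apply, ContinuousLinearMap.intervalIntegral_apply
      (intervalIntegrable_of_memLp_two (E := Hm1 Ω) (Lp.memLp u.dt) ⟨le_rfl, zero_le_one⟩ ht)] at h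

/-- The weak gradient `∇u ∈ L²(I; L²(Ω; ℝ^d))` of `u ∈ W(0,1)`. -/
def spaceTimeGrad (u : W Ω) : Lp (L2Vec Ω) 2 timeMeasure := (grad Ω).compLp u.val

lemma ae_spaceTimeGrad (u : W Ω) :
    ∀ᵐ t ∂timeMeasure, u.spaceTimeGrad t = grad Ω (u.val t) :=
  (grad Ω).coeFn_compLp u.val

end W

lemma integral_norm_sq_eq_norm_sq {E : Type*} [NormedAddCommGroup E] [InnerProductSpace ℝ E]
    {α : Type*} [MeasurableSpace α] {μ : Measure α} (f : Lp E 2 μ) :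
    ∫ t, ‖f t‖ ^ 2 ∂μ = ‖f‖ ^ 2 := by
  simp only [← real_inner_self_eq_norm_sq, L2.inner_def]

variable {X : Type} [MeasurableSpace X] {ρ : Measure X} {B : Lp ℝ 2 ρ →L[ℝ] L2 Ω}
  {u₀ : H10 Ω} {ν ν' : ℝ} {p q r : Q ρ} {u v z : W Ω} {z₁ : L2 Ω}

lemma IsState.ae_dt_apply (hu : IsState B u₀ ν q u) : ∀ᵐ t ∂timeMeasure, ∀ φ, u.dt t φ =
    ν * (⟪B (slice q t), toL2 Ω φ⟫_ℝ - ⟪grad Ω (u.val t), grad Ω φ⟫_ℝ) := by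
  filter_upwards [hu.2] with t ht φ
  have h := congr($ht φ)
  simp only [sub_apply, smul_apply, emb_apply, lap_apply, smul_eq_mul] at h
  linarith

lemma IsAdjointState.ae_dt_apply (hz : IsAdjointState ν z₁ z) :
    ∀ᵐ t ∂timeMeasure, ∀ φ, z.dt t φ = ν * ⟪grad Ω (z.val t), grad Ω φ⟫_ℝ := by
  filter_upwards [hz.2] with t ht φ
  have h := congr($ht φ)
  simp only [sub_apply, neg_apply, smul_apply, lap_apply, smul_eq_mul, zero_apply] at h
  linarith

/-- The pairing `∫₀¹ ⟨B q + Δu, z⟩ dt` of the Hamiltonian, in terms of `p = B*z`. -/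
def hamiltonianPairing (p q : Q ρ) (u z : W Ω) : ℝ :=
  ⟪p, q⟫_ℝ - ⟪u.spaceTimeGrad, z.spaceTimeGrad⟫_ℝ

variable [SFinite ρ]

lemma integrable_hamiltonian (p q : Q ρ) (u z : W Ω) : Integrable
    (fun t => ⟪slice p t, slice q t⟫_ℝ - ⟪u.spaceTimeGrad t, z.spaceTimeGrad t⟫_ℝ) timeMeasure :=
  (integrable_inner_slice p q).sub (L2.integrable_inner _ _)

lemma integral_hamiltonian (p q : Q ρ) (u z : W Ω) :
    ∫ t, (⟪slice p t, slice q t⟫_ℝ - ⟪u.spaceTimeGrad t, z.spaceTimeGrad t⟫_ℝ) ∂timeMeasure =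
      hamiltonianPairing p q u z := by
  rw [integral_sub (integrable_inner_slice p q) (L2.integrable_inner _ _), integral_inner_slice,
    ← L2.inner_def, hamiltonianPairing]

lemma IsObservation.integral_one_add (hp : IsObservation B z p) (q : Q ρ) (u : W Ω) :
    ∫ t in (0 : ℝ)..1, (1 + (emb Ω (B (slice q t)) + lap Ω (u.val t)) (z.val t)) =
      1 + hamiltonianPairing p q u z := by
  have hham : ∀ᵐ t ∂timeMeasure, 1 + (emb Ω (B (slice q t)) + lap Ω (u.val t)) (z.val t) =
      1 + (⟪slice p t, slice q t⟫_ℝ - ⟪u.spaceTimeGrad t, z.spaceTimeGrad t⟫_ℝ) := by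
    filter_upwards [hp.ae_inner_slice_eq q, u.ae_spaceTimeGrad, z.ae_spaceTimeGrad]
      with t hpt hu hz
    rw [add_apply, emb_apply, lap_apply, hpt, hu, hz, ← sub_eq_add_neg]
  rw [← integral_timeMeasure, integral_congr_ae hham,
    integral_add (integrable_const _) (integrable_hamiltonian p q u z), integral_hamiltonian,
    integral_const, probReal_univ, one_smul]

theorem IsState.inner_terminal_sub (hu : IsState B u₀ ν q u) (hv : IsState B u₀ ν' r v)
    (hz : IsAdjointState ν' z₁ z) (hp : IsObservation B z p) :
    ⟪u.path 1 - v.path 1, z₁⟫_ℝ =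
      (ν - ν') * hamiltonianPairing p q u z + ν' * ⟪p, q - r⟫_ℝ := by
  have hintegrand : ∀ᵐ t ∂timeMeasure, (u.dt - v.dt : ℝ → Hm1 Ω) t (z.val t) +
      z.dt t ((u.val - v.val : ℝ → H10 Ω) t) =
      (ν - ν') * (⟪slice p t, slice q t⟫_ℝ - ⟪u.spaceTimeGrad t, z.spaceTimeGrad t⟫_ℝ) +
        ν' * ⟪slice p t, slice (q - r) t⟫_ℝ := by
    filter_upwards [hu.ae_dt_apply, hv.ae_dt_apply, hz.ae_dt_apply, hp.ae_inner_slice_eq q,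
      hp.ae_inner_slice_eq r, ae_slice_sub q r, u.ae_spaceTimeGrad, z.ae_spaceTimeGrad]
      with t hut hvt hzt hpq hpr hsub hgu hgz
    simp only [Pi.sub_apply, sub_apply, hut, hvt, hzt, hpq, hpr, hsub, hgu, hgz, map_sub,
      inner_sub_right, real_inner_comm (grad Ω (z.val t))]
    ring
  have hparts := (u.isEvolution.sub v.isEvolution).inner_eq_add_integral z.isEvolution
    (right_mem_Icc.mpr zero_le_one)
  rw [Pi.sub_apply, Pi.sub_apply, hu.1, hv.1, sub_self, inner_zero_left, zero_add, hz.1,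
    ← integral_timeMeasure] at hparts
  rw [hparts, integral_congr_ae hintegrand,
    integral_add ((integrable_hamiltonian p q u z).const_mul _)
      ((integrable_inner_slice p (q - r)).const_mul _),
    integral_const_mul, integral_const_mul, integral_hamiltonian, integral_inner_slice]

theorem IsState.mul_norm_spaceTimeGrad_sub_sq_le (hν : 0 < ν) (hu : IsState B u₀ ν q u)
    (hv : IsState B u₀ ν' r v) :
    ν * ‖u.spaceTimeGrad - v.spaceTimeGrad‖ ^ 2 ≤
      4 * (‖B‖ ^ 2 * ‖ν • q - ν' • r‖ ^ 2) +
        2 / ν * ((ν - ν') ^ 2 * ‖v.spaceTimeGrad‖ ^ 2) := by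
  have hsource : ∀ᵐ t ∂timeMeasure, ∀ φ, (u.dt - v.dt : ℝ → Hm1 Ω) t φ =
      -ν * ⟪grad Ω ((u.val - v.val : ℝ → H10 Ω) t), grad Ω φ⟫_ℝ +
        ⟪B (slice (ν • q - ν' • r) t), toL2 Ω φ⟫_ℝ +
        ⟪((ν' - ν) • v.spaceTimeGrad) t, grad Ω φ⟫_ℝ := by
    filter_upwards [hu.ae_dt_apply, hv.ae_dt_apply, ae_slice_sub (ν • q) (ν' • r),
      ae_slice_smul ν q, ae_slice_smul ν' r, v.ae_spaceTimeGrad,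
      Lp.coeFn_smul (ν' - ν) v.spaceTimeGrad] with t hut hvt hsub hq hr hgv hsmul φ
    simp only [Pi.sub_apply, sub_apply, hut, hvt, hsub, hq, hr, hsmul, Pi.smul_apply, hgv, map_sub,
      map_smul, inner_sub_left, real_inner_smul_left]
    ring
  have hgrad : ∀ᵐ t ∂timeMeasure, ‖grad Ω ((u.val - v.val : ℝ → H10 Ω) t)‖ ^ 2 =
      ‖(u.spaceTimeGrad - v.spaceTimeGrad) t‖ ^ 2 := by
    filter_upwards [u.ae_spaceTimeGrad, v.ae_spaceTimeGrad,
      Lp.coeFn_sub u.spaceTimeGrad v.spaceTimeGrad] with t hgu hgv hsub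
    rw [hsub, Pi.sub_apply, Pi.sub_apply, map_sub, hgu, hgv]
  have henergy : ν * ∫ t, ‖grad Ω ((u.val - v.val : ℝ → H10 Ω) t)‖ ^ 2 ∂timeMeasure ≤
      4 * (1 - 0) * (∫ t, ‖B‖ ^ 2 * ‖slice (ν • q - ν' • r) t‖ ^ 2 ∂timeMeasure) +
        2 / ν * ∫ t, ‖((ν' - ν) • v.spaceTimeGrad) t‖ ^ 2 ∂timeMeasure :=
    (u.isEvolution.sub v.isEvolution).integral_norm_sq_le_of_source zero_lt_one
    (by rw [Pi.sub_apply, hu.1, hv.1, sub_self]) hν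
    ((integrable_norm_slice_sq (ν • q - ν' • r)).const_mul (‖B‖ ^ 2))
    (fun t => by rw [← mul_pow]; gcongr; exact B.le_opNorm _) (Lp.memLp _) hsource
  rw [integral_congr_ae hgrad, integral_norm_sq_eq_norm_sq, integral_const_mul,
    integral_norm_slice_sq, integral_norm_sq_eq_norm_sq, norm_smul, mul_pow, Real.norm_eq_abs,
    sq_abs, sub_zero, mul_one] at henergy
  rwa [sub_sq_comm ν ν']

end StateEquation

section Sensitivity

lemma norm_smul_sub_smul_sq_le {E : Type*} [NormedAddCommGroup E] [NormedSpace ℝ E] (ν ν' : ℝ)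
    (q r : E) :
    ‖ν • q - ν' • r‖ ^ 2 ≤ 2 * (ν ^ 2 * ‖q - r‖ ^ 2 + (ν - ν') ^ 2 * ‖r‖ ^ 2) := by
  have hsplit : ν • q - ν' • r = ν • (q - r) + (ν - ν') • r := by
    rw [smul_sub, sub_smul, sub_add_sub_cancel]
  calc ‖ν • q - ν' • r‖ ^ 2 ≤ (‖ν • (q - r)‖ + ‖(ν - ν') • r‖) ^ 2 := by
        rw [hsplit]
        gcongr
        exact norm_add_le _ _
    _ ≤ 2 * (‖ν • (q - r)‖ ^ 2 + ‖(ν - ν') • r‖ ^ 2) := add_sq_le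
    _ = 2 * (ν ^ 2 * ‖q - r‖ ^ 2 + (ν - ν') ^ 2 * ‖r‖ ^ 2) := by
        simp only [norm_smul, mul_pow, Real.norm_eq_abs, sq_abs]

variable {d : ℕ} {Ω : Set (Sp d)} {X : Type} [MeasurableSpace X] {ρ : Measure X}
  {B : Lp ℝ 2 ρ →L[ℝ] L2 Ω} {u₀ : H10 Ω} {ν ν' : ℝ} {q r : Q ρ} {u v : W Ω} [SFinite ρ]

lemma IsState.norm_spaceTimeGrad_sub_sq_le (hν : 0 < ν) (hu : IsState B u₀ ν q u)
    (hv : IsState B u₀ ν' r v) :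
    ‖u.spaceTimeGrad - v.spaceTimeGrad‖ ^ 2 ≤ 8 * ν * ‖B‖ ^ 2 * ‖q - r‖ ^ 2 +
      (8 / ν * ‖B‖ ^ 2 * ‖r‖ ^ 2 + 2 / ν ^ 2 * ‖v.spaceTimeGrad‖ ^ 2) * (ν - ν') ^ 2 := by
  refine le_of_mul_le_mul_left ?_ hν
  calc ν * ‖u.spaceTimeGrad - v.spaceTimeGrad‖ ^ 2
      ≤ 4 * (‖B‖ ^ 2 * ‖ν • q - ν' • r‖ ^ 2) +
          2 / ν * ((ν - ν') ^ 2 * ‖v.spaceTimeGrad‖ ^ 2) :=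
        hu.mul_norm_spaceTimeGrad_sub_sq_le hν hv
    _ ≤ 4 * (‖B‖ ^ 2 * (2 * (ν ^ 2 * ‖q - r‖ ^ 2 + (ν - ν') ^ 2 * ‖r‖ ^ 2))) +
          2 / ν * ((ν - ν') ^ 2 * ‖v.spaceTimeGrad‖ ^ 2) := by
        gcongr
        exact norm_smul_sub_smul_sq_le ν ν' q r
    _ = _ := by
        field_simp
        ring

lemma IsState.exists_norm_spaceTimeGrad_sub_sq_le (hν' : 0 < ν') (hv : IsState B u₀ ν' r v) :
    ∃ C ≥ 0, ∀ ν ∈ Icc (ν' / 2) (2 * ν'), ∀ (q : Q ρ) (u : W Ω), IsState B u₀ ν q u →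
      ‖u.spaceTimeGrad - v.spaceTimeGrad‖ ^ 2 ≤ C * (‖q - r‖ ^ 2 + (ν - ν') ^ 2) := by
  set Cq := 8 * (2 * ν') * ‖B‖ ^ 2
  set Cν := 8 / (ν' / 2) * ‖B‖ ^ 2 * ‖r‖ ^ 2 + 2 / (ν' / 2) ^ 2 * ‖v.spaceTimeGrad‖ ^ 2
  have hCq : 0 ≤ Cq := by positivity
  have hCν : 0 ≤ Cν := by positivity
  refine ⟨Cq + Cν, by positivity, fun ν hν q u hu => ?_⟩
  have hνpos : 0 < ν := (half_pos hν').trans_le hν.1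
  calc ‖u.spaceTimeGrad - v.spaceTimeGrad‖ ^ 2
      ≤ 8 * ν * ‖B‖ ^ 2 * ‖q - r‖ ^ 2 +
          (8 / ν * ‖B‖ ^ 2 * ‖r‖ ^ 2 + 2 / ν ^ 2 * ‖v.spaceTimeGrad‖ ^ 2) * (ν - ν') ^ 2 :=
        hu.norm_spaceTimeGrad_sub_sq_le hνpos hv
    _ ≤ Cq * ‖q - r‖ ^ 2 + Cν * (ν - ν') ^ 2 := by
        have hlower := hν.1
        have hupper := hν.2
        simp only [Cq, Cν]
        gcongr
    _ ≤ (Cq + Cν) * ‖q - r‖ ^ 2 + (Cq + Cν) * (ν - ν') ^ 2 := by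
        gcongr
        exacts [le_add_of_nonneg_right hCν, le_add_of_nonneg_left hCq]
    _ = (Cq + Cν) * (‖q - r‖ ^ 2 + (ν - ν') ^ 2) := (mul_add _ _ _).symm

lemma IsState.exists_hamiltonianPairing_sub_sq_le (hν' : 0 < ν') (hv : IsState B u₀ ν' r v)
    (p : Q ρ) (z : W Ω) :
    ∃ C ≥ 0, ∀ ν ∈ Icc (ν' / 2) (2 * ν'), ∀ (q : Q ρ) (u : W Ω), IsState B u₀ ν q u →
      (hamiltonianPairing p q u z - hamiltonianPairing p r v z) ^ 2 ≤
        C * (‖q - r‖ ^ 2 + (ν - ν') ^ 2) := by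
  obtain ⟨C, hC, hgrad⟩ := hv.exists_norm_spaceTimeGrad_sub_sq_le hν'
  refine ⟨2 * (‖p‖ ^ 2 + C * ‖z.spaceTimeGrad‖ ^ 2), by positivity, fun ν hν q u hu => ?_⟩
  have hdiff : hamiltonianPairing p q u z - hamiltonianPairing p r v z =
      ⟪p, q - r⟫_ℝ - ⟪u.spaceTimeGrad - v.spaceTimeGrad, z.spaceTimeGrad⟫_ℝ := by
    simp only [hamiltonianPairing, inner_sub_left, inner_sub_right]
    ring
  have habs : |hamiltonianPairing p q u z - hamiltonianPairing p r v z| ≤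
      ‖p‖ * ‖q - r‖ + ‖u.spaceTimeGrad - v.spaceTimeGrad‖ * ‖z.spaceTimeGrad‖ := by
    rw [hdiff]
    exact (abs_sub _ _).trans
      (add_le_add (abs_real_inner_le_norm _ _) (abs_real_inner_le_norm _ _))
  calc (hamiltonianPairing p q u z - hamiltonianPairing p r v z) ^ 2
      ≤ (‖p‖ * ‖q - r‖ + ‖u.spaceTimeGrad - v.spaceTimeGrad‖ * ‖z.spaceTimeGrad‖) ^ 2 := by
        rw [← sq_abs]
        gcongr
    _ ≤ 2 * (‖p‖ ^ 2 * ‖q - r‖ ^ 2 +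
          ‖u.spaceTimeGrad - v.spaceTimeGrad‖ ^ 2 * ‖z.spaceTimeGrad‖ ^ 2) := by
        rw [← mul_pow, ← mul_pow]
        exact add_sq_le
    _ ≤ 2 * (‖p‖ ^ 2 * (‖q - r‖ ^ 2 + (ν - ν') ^ 2) +
          C * (‖q - r‖ ^ 2 + (ν - ν') ^ 2) * ‖z.spaceTimeGrad‖ ^ 2) := by
        gcongr
        exacts [le_add_of_nonneg_right (sq_nonneg _), hgrad ν hν q u hu]
    _ = _ := by ring

end Sensitivity

section LocalOptimality

-- If `x` is small, then the crude bound on `1 - E` makes `m L`, hence `L` and then `E`, small.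
lemma exists_forall_le_of_le_mul_one_sub {m : ℝ → ℝ} (hm : StrictMonoOn m (Ici 0)) (hm0 : m 0 = 0)
    {C R : ℝ} (hC : 0 ≤ C) (hR : 0 ≤ R) :
    ∃ δ > 0, ∀ x E L : ℝ, |x| ≤ δ → L ∈ Icc 0 R → E ^ 2 ≤ C * (L + x ^ 2) →
      m L ≤ x * (1 - E) → m L ≤ 3 / 2 * x := by
  set η := (8 * (C + 1))⁻¹
  set K := 2 + C * (R + 1)
  have hη : 0 < η := by positivity
  have hη1 : η ≤ 1 := inv_le_one_of_one_le₀ (by linarith)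
  have hCη : C * (η + η) ≤ 1 / 4 := by
    simp only [η]
    field_simp
    linarith
  have hK : 0 < K := by positivity
  have hmη : 0 < m η := hm0 ▸ hm self_mem_Ici hη.le hη
  refine ⟨min η (m η / (2 * K)), by positivity, fun x E L hx hL hE hmL => ?_⟩
  have hxη : x ^ 2 ≤ η := by
    rw [← sq_abs]
    nlinarith [abs_nonneg x, hx.trans (min_le_left _ _)]
  have hcrude : |1 - E| ≤ K := by
    have hE' : E ^ 2 ≤ C * (R + 1) := hE.trans (by gcongr; exacts [hL.2, hxη.trans hη1])
    rw [abs_le]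
    constructor <;> nlinarith [sq_nonneg (E - 1), sq_nonneg (E + 1)]
  have hLη : L < η := by
    rw [← hm.lt_iff_lt hL.1 hη.le]
    calc m L ≤ |x| * |1 - E| := hmL.trans ((le_abs_self _).trans_eq (abs_mul _ _))
      _ ≤ m η / (2 * K) * K := by gcongr; exact hx.trans (min_le_right _ _)
      _ = m η / 2 := by field_simp
      _ < m η := half_lt_self hmη
  have hEhalf : |E| ≤ 1 / 2 := by
    refine abs_le_of_sq_le_sq (hE.trans ?_) (by norm_num)
    exact ((by gcongr : C * (L + x ^ 2) ≤ C * (η + η)).trans hCη).trans_eq (by norm_num)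
  obtain ⟨hE₁, hE₂⟩ := abs_le.mp hEhalf
  have hmL0 : 0 ≤ m L := hm0 ▸ hm.monotoneOn self_mem_Ici hL.1 hL.1
  have hx0 : 0 ≤ x := nonneg_of_mul_nonneg_left (hmL0.trans hmL) (by linarith)
  calc m L ≤ x * (1 - E) := hmL
    _ ≤ x * (3 / 2) := by gcongr; linarith
    _ = 3 / 2 * x := mul_comm _ _

variable {d : ℕ} {Ω : Set (Sp d)} {X : Type} [MeasurableSpace X] {ρ : Measure X}
  {B : Lp ℝ 2 ρ →L[ℝ] L2 Ω} {u₀ ud : H10 Ω} {ν ν' δ₀ qa qb μ : ℝ} {p q qbar : Q ρ}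
  {u ubar z : W Ω} {Ψ : ℝ → ℝ}

lemma IsControlOperator.isFiniteMeasure (hΩ : IsConvexPolytopalDomain Ω)
    (hB : IsControlOperator Ω X ρ B) : IsFiniteMeasure ρ := by
  cases hB with
  | distributed ω _ hsub =>
    obtain ⟨-, s, hs⟩ := hΩ
    have hω : Bornology.IsBounded ω := (isBounded_convexHull.mpr s.finite_toSet.isBounded).subset
      (hsub.trans (hs.trans_subset interior_subset))
    exact ⟨by simpa using hω.measure_lt_top⟩
  | timeDependent => infer_instance

lemma IsStructuralFunction.strictMonoOn_mul_psiInv_mul (hΨ : IsStructuralFunction p Ψ) {k c : ℝ}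
    (hk : 0 < k) (hc : 0 < c) : StrictMonoOn (fun L => k * (psiInv Ψ (c * L) * L)) (Ici 0) := by
  intro x hx y hy hxy
  rw [mem_Ici] at hx hy
  have hypos : 0 < y := hx.trans_lt hxy
  have hmono : psiInv Ψ (c * x) ≤ psiInv Ψ (c * y) :=
    hΨ.psiInv_monotoneOn (mul_nonneg hc.le hx) (mul_nonneg hc.le hy) (by gcongr)
  have hpos : 0 < psiInv Ψ (c * y) := hΨ.psiInv_pos (mul_pos hc hypos)
  refine mul_lt_mul_of_pos_left ?_ hk
  calc psiInv Ψ (c * x) * x ≤ psiInv Ψ (c * y) * x := by gcongr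
    _ < psiInv Ψ (c * y) * y := by gcongr

lemma inner_sub_nonpos_of_G_le {v w : L2 Ω} (h : G ud δ₀ v ≤ G ud δ₀ w) :
    ⟪v - w, w - toL2 Ω ud⟫_ℝ ≤ 0 := by
  have hexpand := norm_add_sq_real (v - w) (w - toL2 Ω ud)
  rw [sub_add_sub_cancel] at hexpand
  unfold G at h
  linarith [sq_nonneg ‖v - w‖]

namespace FirstOrderConditions

lemma admissible (hfirst : FirstOrderConditions B u₀ ud δ₀ qa qb ν' qbar ubar μ z) :
    Admissible B u₀ ud δ₀ qa qb ν' qbar :=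
  ⟨hfirst.time_pos, hfirst.control_mem, ubar, hfirst.state, hfirst.terminal.le⟩

lemma hamiltonianPairing_eq [SFinite ρ]
    (hfirst : FirstOrderConditions B u₀ ud δ₀ qa qb ν' qbar ubar μ z) (hp : IsObservation B z p) :
    hamiltonianPairing p qbar ubar z = -1 :=
  eq_neg_of_add_eq_zero_right ((hp.integral_one_add qbar ubar).symm.trans hfirst.hamiltonian)

lemma inner_sub_nonneg [SFinite ρ]
    (hfirst : FirstOrderConditions B u₀ ud δ₀ qa qb ν' qbar ubar μ z) (hp : IsObservation B z p) :
    ∀ q ∈ Qad ρ qa qb, 0 ≤ ⟪p, q - qbar⟫_ℝ := fun q hq =>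
  (hfirst.variational q hq).trans_eq (hp.integral_inner_adjoint_slice_sub q qbar)

lemma mul_inner_sub_le [SFinite ρ]
    (hfirst : FirstOrderConditions B u₀ ud δ₀ qa qb ν' qbar ubar μ z) (hp : IsObservation B z p)
    (hu : IsState B u₀ ν q u) (hG : G ud δ₀ (u.path 1) ≤ 0) :
    ν' * ⟪p, q - qbar⟫_ℝ ≤ (ν - ν') *
      (1 - (hamiltonianPairing p q u z - hamiltonianPairing p qbar ubar z)) := by
  have hterminal : ⟪u.path 1 - ubar.path 1, μ • (ubar.path 1 - toL2 Ω ud)⟫_ℝ ≤ 0 := by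
    rw [real_inner_smul_right]
    exact mul_nonpos_of_nonneg_of_nonpos hfirst.multiplier_pos.le
      (inner_sub_nonpos_of_G_le (hG.trans_eq hfirst.terminal.symm))
  rw [hu.inner_terminal_sub hfirst.state hfirst.adjoint hp] at hterminal
  rw [hfirst.hamiltonianPairing_eq hp]
  linarith

variable [IsFiniteMeasure ρ]

lemma exists_growth (hfirst : FirstOrderConditions B u₀ ud δ₀ qa qb ν' qbar ubar μ z)
    (hp : IsObservation B z p) (hab : qa < qb) (hΨ : IsStructuralFunction p Ψ) :
    ∃ δ > 0, ∀ (ν : ℝ) (q : Q ρ), Admissible B u₀ ud δ₀ qa qb ν q → |ν - ν'| ≤ δ →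
      ν' / 6 * psiInv Ψ ((2 * (qb - qa))⁻¹ * l1Dist q qbar) * l1Dist q qbar ≤ ν - ν' := by
  have hν' := hfirst.time_pos
  have hba : 0 < qb - qa := sub_pos.mpr hab
  obtain ⟨C, hC, hham⟩ := hfirst.state.exists_hamiltonianPairing_sub_sq_le hν' p z
  obtain ⟨δ, hδ, habsorb⟩ := exists_forall_le_of_le_mul_one_sub
    (hΨ.strictMonoOn_mul_psiInv_mul (half_pos hν') (inv_pos.mpr (mul_pos two_pos hba)))
    (by simp only [mul_zero]) (mul_nonneg hC (by positivity : 0 ≤ qb - qa + 1))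
    (mul_nonneg measureReal_nonneg hba.le : 0 ≤ (stMeasure ρ).real univ * (qb - qa))
  refine ⟨min δ (ν' / 2), lt_min hδ (half_pos hν'), fun ν q hadm hν => ?_⟩
  obtain ⟨-, hq, u, hu, hG⟩ := hadm
  set L := l1Dist q qbar
  have hL : 0 ≤ L := l1Dist_nonneg q qbar
  have hθ : 0 ≤ psiInv Ψ ((2 * (qb - qa))⁻¹ * L) := hΨ.psiInv_nonneg (by positivity)
  have hνmem : ν ∈ Icc (ν' / 2) (2 * ν') := by
    have := abs_le.mp (hν.trans (min_le_right _ _))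
    constructor <;> linarith
  have herror : (hamiltonianPairing p q u z - hamiltonianPairing p qbar ubar z) ^ 2 ≤
      C * (qb - qa + 1) * (L + (ν - ν') ^ 2) := by
    refine (hham ν hνmem q u hu).trans ?_
    rw [mul_assoc]
    gcongr
    nlinarith [norm_sub_sq_le_mul_l1Dist hq hfirst.control_mem, sq_nonneg (ν - ν')]
  have hgrowth : ν' / 2 * (psiInv Ψ ((2 * (qb - qa))⁻¹ * L) * L) ≤ (ν - ν') *
      (1 - (hamiltonianPairing p q u z - hamiltonianPairing p qbar ubar z)) := by
    refine le_trans ?_ (hfirst.mul_inner_sub_le hp hu hG)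
    refine le_trans (le_of_eq (by ring)) (mul_le_mul_of_nonneg_left
      (hΨ.growth hab hfirst.control_mem (hfirst.inner_sub_nonneg hp) hq) hν'.le)
  have hbound := habsorb _ _ L (hν.trans (min_le_left _ _))
    ⟨hL, l1Dist_le_of_mem_Qad hq hfirst.control_mem⟩ herror hgrowth
  have hnonneg : 0 ≤ ν' * (psiInv Ψ ((2 * (qb - qa))⁻¹ * L) * L) := by positivity
  linarith

lemma isLocallyOptimal (hfirst : FirstOrderConditions B u₀ ud δ₀ qa qb ν' qbar ubar μ z)
    (hp : IsObservation B z p) (hab : qa < qb) (hΨ : IsStructuralFunction p Ψ) :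
    IsLocallyOptimal B u₀ ud δ₀ qa qb ν' qbar := by
  obtain ⟨δ, hδ, hgrowth⟩ := hfirst.exists_growth hp hab hΨ
  refine ⟨hfirst.admissible, δ, hδ, fun ν q hadm hν => sub_nonneg.mp (le_trans ?_
    (hgrowth ν q hadm hν))⟩
  have hν' := hfirst.time_pos
  have hL := l1Dist_nonneg q qbar
  have hθ := hΨ.psiInv_nonneg
    (mul_nonneg (inv_nonneg.mpr (mul_nonneg two_pos.le (sub_nonneg.mpr hab.le))) hL)
  positivity

end FirstOrderConditions

end LocalOptimality

end TimeOptimal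

end

theorem mainTheorem1_general
    {d : ℕ} {Ω : Set (TimeOptimal.Sp d)}
    {X : Type} [MeasurableSpace X] (ρ : Measure X) [IsFiniteMeasure ρ]
    (B : Lp ℝ 2 ρ →L[ℝ] TimeOptimal.L2 Ω)
    (u₀ ud : TimeOptimal.H10 Ω) (δ₀ : ℝ) {qa qb : ℝ} (hab : qa < qb)
    (νbar : ℝ) (qbar : TimeOptimal.Q ρ) (ubar : TimeOptimal.W Ω)
    (μbar : ℝ) (zbar : TimeOptimal.W Ω)
    (hfirst : TimeOptimal.FirstOrderConditions B u₀ ud δ₀ qa qb νbar qbar ubar μbar zbar)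
    (p : TimeOptimal.Q ρ) (hp : TimeOptimal.IsObservation B zbar p)
    (hnodal : TimeOptimal.stMeasure ρ {y | p y = 0} = 0) :
    TimeOptimal.IsLocallyOptimal B u₀ ud δ₀ qa qb νbar qbar ∧
    (∃ Ψ : ℝ → ℝ, TimeOptimal.IsStructuralFunction p Ψ) ∧
    ∀ Ψ : ℝ → ℝ, TimeOptimal.IsStructuralFunction p Ψ →
      ∃ δ > 0, ∀ (ν : ℝ) (q : TimeOptimal.Q ρ),
        TimeOptimal.Admissible B u₀ ud δ₀ qa qb ν q → |ν - νbar| ≤ δ →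
        νbar / 6 * TimeOptimal.psiInv Ψ ((2 * (qb - qa))⁻¹ * TimeOptimal.l1Dist q qbar) *
          TimeOptimal.l1Dist q qbar ≤ ν - νbar := by
  obtain ⟨Ψ, hΨ⟩ := TimeOptimal.exists_isStructuralFunction hnodal
  exact ⟨hfirst.isLocallyOptimal hp hab hΨ, ⟨Ψ, hΨ⟩,
    fun _ hΨ' => hfirst.exists_growth hp hab hΨ'⟩

theorem mainTheorem1
    {d : ℕ} (hd : d = 2 ∨ d = 3)
    (Ω : Set (TimeOptimal.Sp d)) (hΩ : TimeOptimal.IsConvexPolytopalDomain Ω)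
    {X : Type} [MeasurableSpace X] (ρ : Measure X)
    (B : Lp ℝ 2 ρ →L[ℝ] TimeOptimal.L2 Ω) (hB : TimeOptimal.IsControlOperator Ω X ρ B)
    (u₀ ud : TimeOptimal.H10 Ω) (δ₀ : ℝ) (hδ₀ : 0 < δ₀)
    (qa qb : ℝ) (hab : qa < qb)
    (νbar : ℝ) (qbar : TimeOptimal.Q ρ) (ubar : TimeOptimal.W Ω)
    (μbar : ℝ) (zbar : TimeOptimal.W Ω)
    (hfirst : TimeOptimal.FirstOrderConditions B u₀ ud δ₀ qa qb νbar qbar ubar μbar zbar)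
    -- `p` is the function `B*z̄` on `I × ω`
    (p : TimeOptimal.Q ρ) (hp : TimeOptimal.IsObservation B zbar p)
    (hnodal : TimeOptimal.stMeasure ρ {y | p y = 0} = 0) :
    TimeOptimal.IsLocallyOptimal B u₀ ud δ₀ qa qb νbar qbar ∧
    (∃ Ψ : ℝ → ℝ, TimeOptimal.IsStructuralFunction p Ψ) ∧
    ∀ Ψ : ℝ → ℝ, TimeOptimal.IsStructuralFunction p Ψ →
      ∃ δ > 0, ∀ (ν : ℝ) (q : TimeOptimal.Q ρ),
        TimeOptimal.Admissible B u₀ ud δ₀ qa qb ν q → |ν - νbar| ≤ δ →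
        νbar / 6 * TimeOptimal.psiInv Ψ ((2 * (qb - qa))⁻¹ * TimeOptimal.l1Dist q qbar) *
          TimeOptimal.l1Dist q qbar ≤ ν - νbar := by
  have := hB.isFiniteMeasure hΩ
  exact mainTheorem1_general ρ B u₀ ud δ₀ hab νbar qbar ubar μbar zbar hfirst p hp hnodal
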